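/- We work over $\mathbb{C}$. Let $r\ge 1$ and let $\pmb n=(n_1,\dots,n_r)$, $\pmb d=(d_1,\dots,d_r)$ be $r$-tuples of positive integers with $n_1\le\dots\le n_r$; put $d=d_1+\dots+d_r$ and $N=\prod_i\binom{n_i+d_i}{n_i}-1$. Let $SV^{\pmb n}_{\pmb d}\subset\mathbb{P}^N$ be the Segre-Veronese variety, that is, the image of $\mathbb{P}^{n_1}\times\dots\times\mathbb{P}^{n_r}$ under the embedding $\sigma\nu$ given by the complete linear system $|\mathcal{O}(d_1,\dots,d_r)|$; for $v=(v_1,\dots,v_r)$ with $0\ne v_i\in\mathbb{C}^{n_i+1}$ write $\sigma\nu(v)=\sigma\nu([v_1],\dots,[v_r])=[v_1^{d_1}\otimes\dots\otimes v_r^{d_r}]$. For a projective variety $X\subset\mathbb{P}^N$, a smooth point $p\in X$ and $k\ge 0$, the $k$-osculating space $T^k_p=T^k_pX$ is the projective closure of the affine space through $p$ spanned by the partial derivatives of order $\le k$ at $0$ of a local parametrization $(\mathbb{C}^{\dim X},0)\to(X,p)$ in an affine chart. For $m\ge 1$, $X$ has *$m$-osculating regularity* if, for general points $p_1,\dots,p_m\in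 X$ and every integer $k\ge 0$, there exist a smooth curve $C$, points $t_0,t_\infty\in C$ and morphisms $\gamma_j:C\to X$, $j=2,\dots,m$, with $\gamma_j(t_0)=p_1$ and $\gamma_j(t_\infty)=p_j$, such that the flat limit $T_0$ at $t_0$ (the limit in the Grassmannian) of the family of linear spaces $T_t=\langle T^k_{p_1},T^k_{\gamma_2(t)},\dots,T^k_{\gamma_m(t)}\rangle$, $t\in C\setminus\{t_0\}$, is contained in $T^{2k+1}_{p_1}$. (General means: in a nonempty Zariski open subset of $X^m$, which does not depend on $k$.) **Proposition.** 1. $SV^{\pmb n}_{\pmb d}$ has $(n_1+1)$-osculating regularity. 2. More precisely, the curves can be taken to be rational normal curves: let $p_0,\dots,p_{n_1}\in SV^{\pmb n}_{\pmb d}$ be general points, and write $p_j=\sigma\nu(v_j)$, $v_j=(v_{j,1},\dots,v_{j,r})$, with arbitrary representatives $v_{j,i}\in\mathbb{C}^{n_i+1}$. Then for $j=1,\dots,n_1$ $$\gamma_j([s:t])=\big[(sv_{0,1}+tv_{j,1})^{d_1}\otimes\dots\otimes(sv_{0,r}+tv_{j,r})^{d_r}\big]$$ is well defined on $\mathbb{P}^1$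 and parametrizes a rational normal curve of degree $d$ contained in $SV^{\pmb n}_{\pmb d}$, with $\gamma_j([1:0])=p_0$ and $\gamma_j([0:1])=p_j$, and for every $k\ge 0$ the flat limit at $[1:0]$ of the family $\langle T^k_{p_0},T^k_{\gamma_1(x)},\dots,T^k_{\gamma_{n_1}(x)}\rangle$, $x\in\mathbb{P}^1\setminus\{[1:0]\}$, exists and is contained in $T^{2k+1}_{p_0}$. -/

import Mathlib

open scoped LinearAlgebra.Projectivization Topology

noncomputable section

namespace SegreVeronese

/-! ### Zariski topology on projective spaces and their powers -/

/-- Zariski closed subsets of `ℙ(ℂ^ι)`: common zero loci of homogeneous polynomials. -/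
def IsZariskiClosed {ι : Type} (Z : Set (ℙ ℂ (ι → ℂ))) : Prop :=
  ∃ S : Set (MvPolynomial ι ℂ), (∀ f ∈ S, ∃ e : ℕ, f.IsHomogeneous e) ∧
    ∀ p, p ∈ Z ↔ ∀ f ∈ S, MvPolynomial.eval p.rep f = 0

/-- `f` is multihomogeneous of multidegree `e` in the `m` groups of variables `(j, ·)`. -/
def IsMultihomogeneous {ι : Type} [Fintype ι] {m : ℕ} (f : MvPolynomial (Fin m × ι) ℂ)
    (e : Fin m → ℕ) : Prop :=
  ∀ s ∈ f.support, ∀ j, ∑ i, s (j, i) = e j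

/-- Zariski closed subsets of the `m`-fold product `ℙ(ℂ^ι) × ⋯ × ℙ(ℂ^ι)`: common zero loci of
multihomogeneous polynomials. -/
def IsZariskiClosedPow {ι : Type} [Fintype ι] {m : ℕ} (Z : Set (Fin m → ℙ ℂ (ι → ℂ))) : Prop :=
  ∃ S : Set (MvPolynomial (Fin m × ι) ℂ), (∀ f ∈ S, ∃ e, IsMultihomogeneous f e) ∧
    ∀ p, p ∈ Z ↔ ∀ f ∈ S, MvPolynomial.eval (fun x : Fin m × ι => (p x.1).rep x.2) f = 0

/-- `P` holds for `m` general points of `X`: it holds on a nonempty Zariski open subset of `X^m`. -/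
def ForGeneralPoints {ι : Type} [Fintype ι] (X : Set (ℙ ℂ (ι → ℂ))) (m : ℕ)
    (P : (Fin m → ℙ ℂ (ι → ℂ)) → Prop) : Prop :=
  ∃ Z : Set (Fin m → ℙ ℂ (ι → ℂ)), IsZariskiClosedPow Z ∧
    (∃ p, (∀ j, p j ∈ X) ∧ p ∉ Z) ∧
    ∀ p, (∀ j, p j ∈ X) → p ∉ Z → P p

/-! ### Local parametrizations and osculating spaces -/

/-- The part of `X` in the affine chart `z_{i₀} ≠ 0`, where the chart is identified with the affine
hyperplane `z_{i₀} = 1` of `ℂ^ι`. -/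
def affinePart {ι : Type} (X : Set (ℙ ℂ (ι → ℂ))) (i₀ : ι) : Set (ι → ℂ) :=
  {w | w i₀ = 1 ∧ ∃ h : w ≠ 0, Projectivization.mk ℂ w h ∈ X}

/-- `φ` is (the germ at `0` of) a local parametrization by `ℂ^n` of `X` at `p`, in the affine chart
`z_{i₀} = 1`: it is holomorphic at `0`, immersive at `0`, sends `0` to `p`, and the images of the
neighbourhoods of `0` are the neighbourhoods of `p` in `X`. Such a `φ` exists exactly when `X` is
near `p` a complex submanifold of dimension `n`. -/
structure IsLocalParametrization {ι : Type} [Fintype ι] (X : Set (ℙ ℂ (ι → ℂ)))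
    (p : ℙ ℂ (ι → ℂ)) (i₀ : ι) {n : ℕ} (φ : (Fin n → ℂ) → (ι → ℂ)) : Prop where
  analyticAt : AnalyticAt ℂ φ 0
  immersive : Function.Injective (fderiv ℂ φ 0)
  mem : φ 0 ∈ affinePart X i₀
  base : ∃ h : φ 0 ≠ 0, Projectivization.mk ℂ (φ 0) h = p
  map_nhds : Filter.map φ (𝓝 0) = 𝓝[affinePart X i₀] (φ 0)

/-- The linear span in `ℂ^ι` of all partial derivatives of `φ` at `0` of order at most `k`, the one
of order zero, `φ 0`, included. If `φ` takes values in `z_{i₀} = 1`, this is the linear subspace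
whose projectivization is the projective closure of the affine subspace through `φ 0` spanned by
the partial derivatives of order between `1` and `k`. -/
def jetSpan {ι : Type} [Fintype ι] {n : ℕ} (φ : (Fin n → ℂ) → (ι → ℂ)) (k : ℕ) :
    Submodule ℂ (ι → ℂ) :=
  Submodule.span ℂ {w | ∃ j : ℕ, j ≤ k ∧ ∃ a : Fin j → Fin n,
    w = iteratedFDeriv ℂ j φ 0 (fun l => Pi.single (a l) 1)}

/-- The `k`-osculating space `T^k_p X`, as a linear subspace of `ℂ^ι`. At a smooth point the space
`jetSpan φ k` is the same for all local parametrizations `φ` of `X` at `p`, since two of them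
differ by a germ of a biholomorphism; the supremum only avoids choosing one. -/
def osculatingSpace {ι : Type} [Fintype ι] (X : Set (ℙ ℂ (ι → ℂ))) (p : ℙ ℂ (ι → ℂ)) (k : ℕ) :
    Submodule ℂ (ι → ℂ) :=
  ⨆ (n : ℕ) (i₀ : ι) (φ : (Fin n → ℂ) → (ι → ℂ)) (_ : IsLocalParametrization X p i₀ φ),
    jetSpan φ k

/-! ### Smooth curves, morphisms, flat limits -/

/-- A smooth (irreducible, quasi-projective) algebraic curve, embedded in `ℙ(ℂ^κ)`. -/
structure IsSmoothCurve {κ : Type} [Fintype κ] (C : Set (ℙ ℂ (κ → ℂ))) : Prop where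
  locallyClosed : ∃ Z₁ Z₂, IsZariskiClosed Z₁ ∧ IsZariskiClosed Z₂ ∧ C = Z₁ \ Z₂
  nonempty : C.Nonempty
  irreducible : ∀ Z₁ Z₂, IsZariskiClosed Z₁ → IsZariskiClosed Z₂ → C ⊆ Z₁ ∪ Z₂ →
    C ⊆ Z₁ ∨ C ⊆ Z₂
  smooth : ∀ c ∈ C, ∃ (i₀ : κ) (φ : (Fin 1 → ℂ) → (κ → ℂ)), IsLocalParametrization C c i₀ φ

/-- The vector of values at `w` of a vector of polynomials. -/
def evalVec {κ ι : Type} (F : ι → MvPolynomial κ ℂ) (w : κ → ℂ) : ι → ℂ :=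
  fun i => MvPolynomial.eval w (F i)

/-- `γ` restricts to a morphism from the quasi-projective set `C` to `X`: near every point of `C`
it is given by homogeneous polynomials of the same degree without a common zero at that point.
(Multiplying these by a form that vanishes outside a given open set, one may assume that they
represent `γ` wherever they do not vanish simultaneously.) -/
def IsMorphism {κ ι : Type} (C : Set (ℙ ℂ (κ → ℂ))) (X : Set (ℙ ℂ (ι → ℂ)))
    (γ : ℙ ℂ (κ → ℂ) → ℙ ℂ (ι → ℂ)) : Prop :=
  (∀ c ∈ C, γ c ∈ X) ∧
  ∀ c ∈ C, ∃ (e : ℕ) (F : ι → MvPolynomial κ ℂ), (∀ i, (F i).IsHomogeneous e) ∧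
    evalVec F c.rep ≠ 0 ∧
    ∀ c' ∈ C, ∀ h : evalVec F c'.rep ≠ 0, γ c' = Projectivization.mk ℂ (evalVec F c'.rep) h

/-- `T₀` is the flat limit at `t₀ ∈ C` of the family of linear spaces `T t`, `t ∈ C \ {t₀}`: for
some `D`, the map `t ↦ T t` is on a punctured Zariski neighbourhood of `t₀` in `C` a morphism to the
Grassmannian of `D`-dimensional subspaces, which extends to `t₀` with value `T₀`. Morphisms to the
Grassmannian are given locally by algebraic frames, here with homogeneous coordinates. -/
def IsFlatLimit {κ ι : Type} (C : Set (ℙ ℂ (κ → ℂ))) (t₀ : ℙ ℂ (κ → ℂ))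
    (T : ℙ ℂ (κ → ℂ) → Submodule ℂ (ι → ℂ)) (T₀ : Submodule ℂ (ι → ℂ)) : Prop :=
  ∃ (D : ℕ) (e : Fin D → ℕ) (G : Fin D → ι → MvPolynomial κ ℂ),
    (∀ a i, (G a i).IsHomogeneous (e a)) ∧
    LinearIndependent ℂ (fun a => evalVec (G a) t₀.rep) ∧
    T₀ = Submodule.span ℂ (Set.range fun a => evalVec (G a) t₀.rep) ∧
    ∃ Z, IsZariskiClosed Z ∧ t₀ ∉ Z ∧ ∀ t ∈ C, t ≠ t₀ → t ∉ Z →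
      LinearIndependent ℂ (fun a => evalVec (G a) t.rep) ∧
      T t = Submodule.span ℂ (Set.range fun a => evalVec (G a) t.rep)

/-! ### Osculating regularity -/

/-- The linear span `⟨T^k_p, T^k_{γ_j(t)} : j ≠ 0⟩` of osculating spaces of `X`. -/
def spanOsculating {κ ι : Type} [Fintype ι] (X : Set (ℙ ℂ (ι → ℂ))) {m : ℕ} [NeZero m]
    (p : ℙ ℂ (ι → ℂ)) (γ : Fin m → ℙ ℂ (κ → ℂ) → ℙ ℂ (ι → ℂ)) (k : ℕ) (t : ℙ ℂ (κ → ℂ)) :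
    Submodule ℂ (ι → ℂ) :=
  osculatingSpace X p k ⊔ ⨆ (j : Fin m) (_ : j ≠ 0), osculatingSpace X (γ j t) k

/-- `X` has `m`-osculating regularity. The points are `p 0, …, p (m - 1)`, and `p 0` is the point
to which the others are moved. -/
def HasOsculatingRegularity {ι : Type} [Fintype ι] (X : Set (ℙ ℂ (ι → ℂ))) (m : ℕ) [NeZero m] :
    Prop :=
  ForGeneralPoints X m fun p => ∀ k : ℕ,
    ∃ (M : ℕ) (C : Set (ℙ ℂ (Fin (M + 1) → ℂ)))
      (γ : Fin m → ℙ ℂ (Fin (M + 1) → ℂ) → ℙ ℂ (ι → ℂ)) (t₀ t₁ : ℙ ℂ (Fin (M + 1) → ℂ)),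
      IsSmoothCurve C ∧ t₀ ∈ C ∧ t₁ ∈ C ∧
      (∀ j, j ≠ 0 → IsMorphism C X (γ j) ∧ γ j t₀ = p 0 ∧ γ j t₁ = p j) ∧
      ∃ T₀, IsFlatLimit C t₀ (spanOsculating X (p 0) γ k) T₀ ∧
        T₀ ≤ osculatingSpace X (p 0) (2 * k + 1)

/-! ### Segre-Veronese varieties -/

/-- The index set `Λ_{n,d} = ∏ Λ_{n_i,d_i}` of the homogeneous coordinates: the `i`-th component is
a multiset of size `d i` of indices in `{0, …, n i}`. -/
abbrev Index {r : ℕ} (n d : Fin r → ℕ) : Type := ∀ i, Sym (Fin (n i + 1)) (d i)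

/-- All monomials of multidegree `d` in the coordinates of the vectors `v i ∈ ℂ^(n i + 1)`: the
map on vectors that induces the embedding by the complete linear system of `𝒪(d_1, …, d_r)`. -/
def monomialMap {r : ℕ} (n d : Fin r → ℕ) (v : ∀ i, Fin (n i + 1) → ℂ) : Index n d → ℂ :=
  fun K => ∏ i, ((K i : Multiset (Fin (n i + 1))).map (v i)).prod

theorem monomialMap_ne_zero {r : ℕ} (n d : Fin r → ℕ) (v : ∀ i, Fin (n i + 1) → ℂ)
    (hv : ∀ i, v i ≠ 0) : monomialMap n d v ≠ 0 := by
  choose a ha using fun i => Function.ne_iff.1 (hv i)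
  intro h
  have h1 := congrFun h (fun i => Sym.replicate (d i) (a i))
  simp only [monomialMap, Sym.coe_replicate, Multiset.map_replicate, Multiset.prod_replicate,
    Pi.zero_apply] at h1
  exact Finset.prod_ne_zero_iff.2 (fun i _ => pow_ne_zero _ (ha i)) h1

/-- The Segre-Veronese embedding `ℙ^{n_1} × ⋯ × ℙ^{n_r} → ℙ^N`. -/
def embedding {r : ℕ} (n d : Fin r → ℕ) (x : ∀ i, ℙ ℂ (Fin (n i + 1) → ℂ)) :
    ℙ ℂ (Index n d → ℂ) :=
  Projectivization.mk ℂ (monomialMap n d fun i => (x i).rep)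
    (monomialMap_ne_zero n d _ fun i => (x i).rep_nonzero)

/-- The Segre-Veronese variety. -/
def variety {r : ℕ} (n d : Fin r → ℕ) : Set (ℙ ℂ (Index n d → ℂ)) :=
  Set.range (embedding n d)

/-! ### Rational normal curves -/

/-- The point `[1 : 0]` of `ℙ^1`, with homogeneous coordinates `[s : t]`. -/
def pointZero : ℙ ℂ (Fin 2 → ℂ) := Projectivization.mk ℂ ![1, 0] (by simp)

/-- The point `[0 : 1]` of `ℙ^1`, with homogeneous coordinates `[s : t]`. -/
def pointInfty : ℙ ℂ (Fin 2 → ℂ) := Projectivization.mk ℂ ![0, 1] (by simp)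

/-- `γ` parametrizes a rational normal curve of degree `e` (in its linear span): it is
`[s : t] ↦ [∑ s^(e-l) t^l w_l]` with linearly independent `w_0, …, w_e`. -/
def IsRationalNormalCurve {ι : Type} (e : ℕ) (γ : ℙ ℂ (Fin 2 → ℂ) → ℙ ℂ (ι → ℂ)) : Prop :=
  ∃ w : Fin (e + 1) → ι → ℂ, LinearIndependent ℂ w ∧
    ∀ (s t : ℂ) (h : ![s, t] ≠ 0),
      ∃ h' : (∑ l : Fin (e + 1), (s ^ (e - (l : ℕ)) * t ^ (l : ℕ)) • w l) ≠ 0,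
        γ (Projectivization.mk ℂ ![s, t] h) = Projectivization.mk ℂ _ h'

end SegreVeronese

end

noncomputable section

namespace SegreVeronese

/-! All inclusions of linear spaces are checked on annihilators. A linear form `l` on the ambient
space pulls back to the form `l ⬝ᵥ mon u` of multidegree `d` in the vectors `u i`, and `l` kills the
`k`-osculating space at the image of `v` exactly when this form vanishes to order `k + 1` at `v`
(`osculatingSpace_variety` with `vanishesToOrder_mon_iff`). Along the curve through `v 0` and `v j`,
with affine parameter `τ`, the osculating spaces are spanned by Taylor coefficients at `v 0 + τ v
j`, which are polynomial in `τ`. The flat limit is then the value at `0` of the saturation of a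
submodule of `ℂ[T]^N`, and if functionals `L τ`, polynomial in `τ`, kill the family, then `L 0`
kills the limit (`exists_isFlatLimit`).

It remains to deform: each form vanishing to order `2k + 2` at `v 0` has to be the value at `τ = 0`
of a polynomial family of forms vanishing to order `k + 1` at `v 0` and at all `v 0 + τ v j`
(`exists_deformation`). For general points the vectors `v j i` are linearly independent in every
factor `i`, which is possible because there are `n 0 + 1` of them and `n 0` is the smallest
dimension. Extend them to bases. In the dual coordinates the form is a combination of monomials with
at least `2k + 2` factors `x_b`, `b ≠ 0`. In each monomial, replace some of these factors by `x_b -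
τ x_0`. A factor with `b ≠ 0` vanishes at `v 0` if it is not shifted; it vanishes at `v 0 + τ v j`
if it is shifted and `b = j`, or not shifted and `b ≠ j`. If some label `j₁` occurs at least `k + 1`
times, shift all its occurrences except `k + 1` of them; otherwise shift nothing. At each of the
points at least `k + 1` factors vanish (`exists_shift`). -/

/-- The element of `Sym β d` with the entries of a function on `Fin d`. -/
def symOfFun {β : Type*} {d : ℕ} (κ : Fin d → β) : Sym β d :=
  ⟨Finset.univ.val.map κ, by simp⟩

theorem symOfFun_surjective {β : Type*} {d : ℕ} (K : Sym β d) :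
    ∃ κ : Fin d → β, symOfFun κ = K := by
  obtain ⟨s, hs⟩ := K
  induction s using Quotient.inductionOn with
  | h l =>
    have hl : l.length = d := hs
    subst hl
    refine ⟨l.get, Subtype.ext ?_⟩
    simp [symOfFun, Fin.univ_val_map]

/-- All monomials of multidegree `d` in the coordinates of the families `x i`. -/
def mon {r : ℕ} {β : Fin r → Type} {R : Type*} [CommSemiring R] {d : Fin r → ℕ}
    (x : ∀ i, β i → R) (K : ∀ i, Sym (β i) (d i)) : R :=
  ∏ i, ((K i : Multiset (β i)).map (x i)).prod

theorem monomialMap_eq_mon {r : ℕ} (n d : Fin r → ℕ) (v : ∀ i, Fin (n i + 1) → ℂ) :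
    monomialMap n d v = mon v := rfl

/-! ### Monomials of multidegree `d` and expansions of products of linear forms. -/

section Mon

variable {r : ℕ} {β : Fin r → Type} {R S : Type*} [CommSemiring R] [CommSemiring S]
  {d : Fin r → ℕ}

theorem mon_symOfFun (x : ∀ i, β i → R) (κ : ∀ i, Fin (d i) → β i) :
    mon x (fun i => symOfFun (κ i)) = ∏ i, ∏ q, x i (κ i q) := by
  simp only [mon, symOfFun, Sym.coe_mk, Multiset.map_map, Finset.prod, Function.comp_def]

theorem mon_smul (c : Fin r → R) (x : ∀ i, β i → R) (K : ∀ i, Sym (β i) (d i)) :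
    mon (fun i => c i • x i) K = (∏ i, c i ^ d i) * mon x K := by
  choose κ hκ using fun i => symOfFun_surjective (K i)
  obtain rfl : (fun i => symOfFun (κ i)) = K := funext hκ
  simp only [mon_symOfFun, Pi.smul_apply, smul_eq_mul, Finset.prod_mul_distrib, Finset.prod_const,
    Finset.card_univ, Fintype.card_fin]

theorem map_mon (f : R →+* S) (x : ∀ i, β i → R) (K : ∀ i, Sym (β i) (d i)) :
    f (mon x K) = mon (fun i b => f (x i b)) K := by
  choose κ hκ using fun i => symOfFun_surjective (K i)
  obtain rfl : (fun i => symOfFun (κ i)) = K := funext hκ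
  simp only [mon_symOfFun, map_prod]

/-- The coefficients of a product of linear forms, `d i` of them in the `i`-th group of variables,
with respect to the monomials of multidegree `d`. -/
def formProdCoeff [∀ i, Fintype (β i)] [∀ i, DecidableEq (β i)]
    (l : ∀ i, Fin (d i) → β i → R)
    (K : ∀ i, Sym (β i) (d i)) : R :=
  ∏ i, ∑ κ : Fin (d i) → β i with symOfFun κ = K i, ∏ q, l i q (κ q)

theorem map_formProdCoeff [∀ i, Fintype (β i)] [∀ i, DecidableEq (β i)] (f : R →+* S) (l : ∀ i, Fin (d i) → β i → R)
    (K : ∀ i, Sym (β i) (d i)) :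
    f (formProdCoeff l K) = formProdCoeff (fun i q b => f (l i q b)) K := by
  simp only [formProdCoeff, map_prod, map_sum]

/-- Expand the product over all choices `κ` of one variable per factor and group the choices by the
multiset of chosen variables. This turns any product of linear forms into a functional applied to
`mon x`; changes of basis, shifted monomials and the functionals on rational normal curves all use
it. -/
theorem sum_formProdCoeff_mul_mon [∀ i, Fintype (β i)] [∀ i, DecidableEq (β i)]
    (l : ∀ i, Fin (d i) → β i → R) (x : ∀ i, β i → R) :
    ∑ K : ∀ i, Sym (β i) (d i), formProdCoeff l K * mon x K =
      ∏ i, ∏ q, ∑ b, l i q b * x i b := by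
  classical
  have h1 : ∀ i, ∏ q, ∑ b, l i q b * x i b =
      ∑ K : Sym (β i) (d i), (∑ κ : Fin (d i) → β i with symOfFun κ = K, ∏ q, l i q (κ q)) *
        ((K : Multiset (β i)).map (x i)).prod := by
    intro i
    rw [Finset.prod_univ_sum, Fintype.piFinset_univ,
      ← Finset.sum_fiberwise Finset.univ (fun κ : Fin (d i) → β i => symOfFun κ)]
    refine Finset.sum_congr rfl fun K _ => ?_
    rw [Finset.sum_mul]
    refine Finset.sum_congr rfl fun κ hκ => ?_
    rw [← (Finset.mem_filter.1 hκ).2]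
    rw [Finset.prod_mul_distrib]
    simp only [symOfFun, Sym.coe_mk, Multiset.map_map, Finset.prod, Function.comp_def]
  simp only [h1, Finset.prod_univ_sum, Fintype.piFinset_univ, formProdCoeff, mon,
    Finset.prod_mul_distrib]

end Mon

/-! ### Order of vanishing of polynomials -/

open Asymptotics

theorem isBigO_pow_of_le {E : Type*} [SeminormedAddCommGroup E] {a b : ℕ} (h : a ≤ b) :
    (fun x : E => ‖x‖ ^ b) =O[𝓝 0] fun x => ‖x‖ ^ a := by
  refine IsBigO.of_bound 1 ?_
  filter_upwards [Metric.ball_mem_nhds (0 : E) one_pos] with x hx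
  rw [mem_ball_zero_iff] at hx
  simpa using pow_le_pow_of_le_one (norm_nonneg x) hx.le h

theorem eval_smul_of_isHomogeneous {σ : Type*} {R : Type*} [CommSemiring R]
    {Q : MvPolynomial σ R} {k : ℕ} (hQ : Q.IsHomogeneous k) (t : R) (x : σ → R) :
    MvPolynomial.eval (t • x) Q = t ^ k * MvPolynomial.eval x Q := by
  rw [MvPolynomial.eval_eq, MvPolynomial.eval_eq, Finset.mul_sum]
  refine Finset.sum_congr rfl fun α hα => ?_
  rw [hQ.degree_eq_sum_deg_support hα, ← Finset.prod_pow_eq_pow_sum]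
  simp only [Pi.smul_apply, smul_eq_mul, mul_pow, Finset.prod_mul_distrib]
  ring

section Poly

variable {σ : Type*} [Fintype σ]

theorem isBigO_eval_monomial (α : σ →₀ ℕ) (c : ℂ) :
    (fun h : σ → ℂ => MvPolynomial.eval h (MvPolynomial.monomial α c)) =O[𝓝 0]
      fun h => ‖h‖ ^ α.degree := by
  refine IsBigO.of_bound ‖c‖ (Filter.Eventually.of_forall fun h => ?_)
  rw [MvPolynomial.eval_monomial, norm_mul, Finsupp.prod, norm_prod, norm_pow, norm_norm,
    Finsupp.degree_apply, ← Finset.prod_pow_eq_pow_sum]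
  gcongr with i
  rw [norm_pow]
  gcongr
  exact norm_le_pi_norm h i

theorem isBigO_eval_of_coeff_eq_zero (Q : MvPolynomial σ ℂ) (k : ℕ)
    (hQ : ∀ α : σ →₀ ℕ, α.degree < k → Q.coeff α = 0) :
    (fun h : σ → ℂ => MvPolynomial.eval h Q) =O[𝓝 0] fun h => ‖h‖ ^ k := by
  have h1 : (fun h : σ → ℂ => MvPolynomial.eval h Q) = fun h => ∑ α ∈ Q.support,
      MvPolynomial.eval h (MvPolynomial.monomial α (Q.coeff α)) := by
    funext h
    conv_lhs => rw [Q.as_sum, map_sum]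
  rw [h1]
  refine IsBigO.fun_sum fun α hα =>
    (isBigO_eval_monomial α _).trans (isBigO_pow_of_le (E := σ → ℂ) ?_)
  by_contra hlt
  exact MvPolynomial.mem_support_iff.1 hα (hQ α (not_le.1 hlt))

/-- On the line `t • x` the bound reads `t ^ k * Q(x) = O(t ^ (k + 1))`; divide by `t ^ k` and let
`t` tend to `0`. -/
theorem eval_eq_zero_of_isBigO {Q : MvPolynomial σ ℂ} {k : ℕ} (hQ : Q.IsHomogeneous k)
    (h : (fun h : σ → ℂ => MvPolynomial.eval h Q) =O[𝓝 0] fun h => ‖h‖ ^ (k + 1))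
    (x : σ → ℂ) : MvPolynomial.eval x Q = 0 := by
  have hlim : Filter.Tendsto (fun t : ℂ => t • x) (𝓝[≠] 0) (𝓝 0) := by
    have : Filter.Tendsto (fun t : ℂ => t • x) (𝓝 0) (𝓝 ((0 : ℂ) • x)) :=
      (continuous_id.smul continuous_const).tendsto 0
    rw [zero_smul] at this
    exact this.mono_left nhdsWithin_le_nhds
  have h2 : (fun _ : ℂ => MvPolynomial.eval x Q) =O[𝓝[≠] 0] fun t : ℂ => ‖t‖ := by
    obtain ⟨C, hC⟩ := (h.comp_tendsto hlim).bound
    refine IsBigO.of_bound (C * ‖x‖ ^ (k + 1)) ?_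
    filter_upwards [hC, self_mem_nhdsWithin] with t ht ht0
    have ht0 : 0 < ‖t‖ := norm_pos_iff.2 ht0
    simp only [Function.comp_apply] at ht
    have e : MvPolynomial.eval (t • x) Q = t ^ k * MvPolynomial.eval x Q := by
      exact eval_smul_of_isHomogeneous hQ t x
    rw [e, norm_mul, norm_pow, norm_pow, norm_norm, norm_smul, mul_pow, pow_succ ‖t‖ k] at ht
    rw [norm_norm]
    have : 0 < ‖t‖ ^ k := by positivity
    refine le_of_mul_le_mul_left ?_ this
    calc _ ≤ _ := ht
      _ = _ := by ring
  have h3 : Filter.Tendsto (fun t : ℂ => ‖t‖) (𝓝[≠] 0) (𝓝 0) := by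
    simpa using (continuous_norm.tendsto (0 : ℂ)).mono_left nhdsWithin_le_nhds
  exact tendsto_nhds_unique tendsto_const_nhds (h2.trans_tendsto h3)

/-- Induction on the order: once the coefficients of degree below `k` vanish, `Q` minus its
component of degree `k` is `O(‖h‖ ^ (k + 1))`. Hence so is that component, and a form of degree `k`
that small is zero. -/
theorem isBigO_eval_iff (Q : MvPolynomial σ ℂ) (k : ℕ) :
    (fun h : σ → ℂ => MvPolynomial.eval h Q) =O[𝓝 0] (fun h => ‖h‖ ^ k) ↔
      ∀ α : σ →₀ ℕ, α.degree < k → Q.coeff α = 0 := by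
  refine ⟨fun h => ?_, isBigO_eval_of_coeff_eq_zero Q k⟩
  induction k with
  | zero => intro α hα; exact absurd hα (Nat.not_lt_zero _)
  | succ k ih =>
    have ih := ih (h.trans (isBigO_pow_of_le k.le_succ))
    have h1 : (fun h : σ → ℂ => MvPolynomial.eval h (Q - MvPolynomial.homogeneousComponent k Q))
        =O[𝓝 0] fun h => ‖h‖ ^ (k + 1) := by
      refine isBigO_eval_of_coeff_eq_zero _ _ fun α hα => ?_
      rw [MvPolynomial.coeff_sub, MvPolynomial.coeff_homogeneousComponent]
      split_ifs with hk
      · exact sub_self _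
      · rw [ih α (by omega), sub_zero]
    have h2 : (fun h : σ → ℂ => MvPolynomial.eval h (MvPolynomial.homogeneousComponent k Q))
        =O[𝓝 0] fun h => ‖h‖ ^ (k + 1) := by
      simpa using h.sub h1
    have h3 : MvPolynomial.homogeneousComponent k Q = 0 := MvPolynomial.funext fun x => by
      rw [eval_eq_zero_of_isBigO (MvPolynomial.homogeneousComponent_isHomogeneous k Q) h2, map_zero]
    intro α hα
    rcases Nat.lt_succ_iff_lt_or_eq.1 hα with hα | hα
    · exact ih α hα
    · have := congrArg (MvPolynomial.coeff α) h3
      rwa [MvPolynomial.coeff_homogeneousComponent, if_pos hα, MvPolynomial.coeff_zero] at this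

end Poly

/-! ### Order of vanishing of functions -/

/-- `F` vanishes to order at least `k` at `x`. -/
def VanishesToOrder {E : Type*} [NormedAddCommGroup E] (k : ℕ) (F : E → ℂ) (x : E) : Prop :=
  F =O[𝓝 x] fun y => ‖y - x‖ ^ k

section Order

variable {E : Type*} [NormedAddCommGroup E] {k : ℕ}

theorem vanishesToOrder_zero_iff {F : E → ℂ} :
    VanishesToOrder k F 0 ↔ F =O[𝓝 0] fun y => ‖y‖ ^ k := by
  simp only [VanishesToOrder, sub_zero]

theorem VanishesToOrder.mono {F : E → ℂ} {x : E} {a b : ℕ} (h : VanishesToOrder b F x)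
    (hab : a ≤ b) : VanishesToOrder a F x := by
  refine IsBigO.trans h ?_
  have h1 : Filter.Tendsto (fun y => y - x) (𝓝 x) (𝓝 0) := by
    have : ContinuousAt (fun y => y - x) x := by fun_prop
    simpa [ContinuousAt] using this
  exact (isBigO_pow_of_le (E := E) hab).comp_tendsto h1

theorem VanishesToOrder.prod {ι : Type*} (s : Finset ι) {F : ι → E → ℂ} {a : ι → ℕ} {x : E}
    (h : ∀ i ∈ s, VanishesToOrder (a i) (F i) x) :
    VanishesToOrder (∑ i ∈ s, a i) (fun y => ∏ i ∈ s, F i y) x := by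
  classical
  induction s using Finset.induction_on with
  | empty => simpa [VanishesToOrder] using isBigO_const_const (1 : ℂ) (one_ne_zero (α := ℝ)) (𝓝 x)
  | insert i s hi ih =>
    simp only [Finset.prod_insert hi, Finset.sum_insert hi]
    have := (h i (Finset.mem_insert_self i s)).mul
      (ih fun j hj => h j (Finset.mem_insert_of_mem hj))
    simpa only [VanishesToOrder, pow_add] using this

theorem VanishesToOrder.sum {ι : Type*} (s : Finset ι) {F : ι → E → ℂ} {x : E}
    (h : ∀ i ∈ s, VanishesToOrder k (F i) x) :
    VanishesToOrder k (fun y => ∑ i ∈ s, F i y) x :=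
  IsBigO.fun_sum h

theorem vanishesToOrder_zero_of_continuousAt {F : E → ℂ} {x : E} (hF : ContinuousAt F x) :
    VanishesToOrder 0 F x := by
  simpa only [VanishesToOrder, pow_zero] using hF.tendsto.isBigO_one ℝ

variable {E' : Type*} [NormedSpace ℂ E] [NormedAddCommGroup E'] [NormedSpace ℂ E']

/-- This takes the place of the chain rule for higher derivatives: only differentiability of `g` and
continuity of the factor `c` are needed. It moves orders of vanishing between parametrizations, the
multicone and bases. -/
theorem VanishesToOrder.transport {F : E' → ℂ} {f : E → ℂ} {g : E → E'} {c : E → ℂ} {x : E}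
    {y : E'} (hF : VanishesToOrder k F y) (hg : DifferentiableAt ℂ g x) (hgx : g x = y)
    (hc : ContinuousAt c x) (hf : ∀ᶠ z in 𝓝 x, f z = c z * F (g z)) :
    VanishesToOrder k f x := by
  subst hgx
  have h1 : (fun z => F (g z)) =O[𝓝 x] fun z => ‖g z - g x‖ ^ k :=
    hF.comp_tendsto hg.continuousAt.tendsto
  have h2 : (fun z => ‖g z - g x‖ ^ k) =O[𝓝 x] fun z => ‖z - x‖ ^ k :=
    (hg.isBigO_sub.norm_norm).pow k
  have h3 : c =O[𝓝 x] fun _ => (1 : ℝ) := hc.tendsto.isBigO_one ℝ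
  have h4 := (h3.mul (h1.trans h2)).congr_left fun _ => rfl
  simp only [one_mul] at h4
  exact h4.congr' (hf.mono fun z hz => hz.symm) Filter.EventuallyEq.rfl

theorem vanishesToOrder_one_of_differentiableAt {F : E → ℂ} {x : E}
    (hF : DifferentiableAt ℂ F x) (hx : F x = 0) : VanishesToOrder 1 F x := by
  have := hF.isBigO_sub
  simpa only [VanishesToOrder, hx, sub_zero, pow_one] using this.norm_right

/-- By induction the terms of the power series vanish on the diagonal up to degree `k`: the first
possibly nonzero one equals a partial sum, so it is too small to be nonzero. The iterated derivative
is the symmetrization of that term, hence determined by its diagonal values. -/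
theorem iteratedFDeriv_eq_zero_of_vanishesToOrder {f : E → ℂ} (hf : AnalyticAt ℂ f 0)
    (h : VanishesToOrder (k + 1) f 0) {j : ℕ} (hj : j ≤ k) (v : Fin j → E) :
    iteratedFDeriv ℂ j f 0 v = 0 := by
  obtain ⟨p, r, hp⟩ := hf
  have hdiag : ∀ j ≤ k, ∀ y, (p j fun _ => y) = 0 := by
    intro j
    induction j using Nat.strong_induction_on with
    | _ j ih =>
      intro hj
      have h1 : p.partialSum (j + 1) = fun y => p j fun _ => y := by
        funext z
        refine Finset.sum_eq_single _ (fun b hb hbj => ?_) fun hn => ?_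
        · have := Finset.mem_range_succ_iff.mp hb
          exact ih b (by omega) (by omega) z
        · exact absurd (Finset.mem_range.mpr (lt_add_one j)) hn
      have h2 := hp.hasFPowerSeriesAt.isBigO_sub_partialSum_pow (j + 1)
      simp only [h1, zero_add] at h2
      have h3 := (vanishesToOrder_zero_iff.1 (h.mono (Nat.succ_le_succ hj))).sub h2
      simp only [sub_sub_cancel] at h3
      exact h3.continuousMultilinearMap_apply_eq_zero
  rw [hp.iteratedFDeriv_eq_sum_of_completeSpace,
    ← ContinuousMultilinearMap.iteratedFDeriv_comp_diagonal (p j) 0 v]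
  simp only [hdiag j hj]
  rw [iteratedFDeriv_fun_zero]
  rfl

theorem vanishesToOrder_of_iteratedFDeriv_eq_zero {f : E → ℂ} (hf : AnalyticAt ℂ f 0)
    (h : ∀ j ≤ k, iteratedFDeriv ℂ j f 0 = 0) : VanishesToOrder (k + 1) f 0 := by
  obtain ⟨p, r, hp⟩ := hf
  rw [vanishesToOrder_zero_iff]
  have h1 := hp.hasFPowerSeriesAt.isBigO_sub_partialSum_pow (k + 1)
  have h2 : ∀ y, p.partialSum (k + 1) y = 0 := by
    intro y
    refine Finset.sum_eq_zero fun j hj => ?_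
    have := hp.factorial_smul y j
    rw [h j (Finset.mem_range_succ_iff.1 hj)] at this
    simpa [Nat.factorial_ne_zero] using this
  simpa only [h2, sub_zero, zero_add] using h1

end Order

theorem vanishesToOrder_eval_iff {σ : Type*} [Fintype σ] (Q : MvPolynomial σ ℂ) (k : ℕ) :
    VanishesToOrder k (fun h : σ → ℂ => MvPolynomial.eval h Q) 0 ↔
      ∀ α : σ →₀ ℕ, α.degree < k → Q.coeff α = 0 := by
  rw [vanishesToOrder_zero_iff, isBigO_eval_iff]

/-! ### Annihilators -/

/-- A vector outside `N` is separated from `N` by a linear functional, and every functional on `ι →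
ℂ` is a dot product. -/
theorem span_le_of_dotProduct {ι : Type*} [Fintype ι] {S : Set (ι → ℂ)}
    {N : Submodule ℂ (ι → ℂ)}
    (h : ∀ l : ι → ℂ, (∀ w ∈ N, l ⬝ᵥ w = 0) → ∀ w ∈ S, l ⬝ᵥ w = 0) :
    Submodule.span ℂ S ≤ N := by
  classical
  refine Submodule.span_le.2 fun w hw => ?_
  by_contra hwN
  obtain ⟨f, hf, hN⟩ := Submodule.exists_le_ker_of_notMem hwN
  have hdot : ∀ u, (fun K => f (Pi.single K 1)) ⬝ᵥ u = f u := by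
    intro u
    conv_rhs => rw [pi_eq_sum_univ' u, map_sum]
    refine Finset.sum_congr rfl fun K _ => ?_
    rw [map_smul, smul_eq_mul, mul_comm]
  refine hf ?_
  rw [← hdot]
  exact h _ (fun u hu => by rw [hdot]; exact hN hu) w hw

theorem dotProduct_span {ι : Type*} [Fintype ι] {S : Set (ι → ℂ)} {l : ι → ℂ}
    (h : ∀ w ∈ S, l ⬝ᵥ w = 0) {w : ι → ℂ} (hw : w ∈ Submodule.span ℂ S) : l ⬝ᵥ w = 0 := by
  induction hw using Submodule.span_induction with
  | mem w hw => exact h w hw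
  | zero => simp
  | add x y _ _ hx hy => rw [dotProduct_add, hx, hy, add_zero]
  | smul a x _ hx => rw [dotProduct_smul, hx, smul_zero]

theorem jetSpan_annihilator_iff {ι : Type} [Fintype ι] {n : ℕ} {φ : (Fin n → ℂ) → (ι → ℂ)}
    (hφ : AnalyticAt ℂ φ 0) (k : ℕ) (l : ι → ℂ) :
    (∀ w ∈ jetSpan φ k, l ⬝ᵥ w = 0) ↔ VanishesToOrder (k + 1) (fun x => l ⬝ᵥ φ x) 0 := by
  let L : (ι → ℂ) →L[ℂ] ℂ := ∑ i, l i • ContinuousLinearMap.proj i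
  have hL : ∀ w, L w = l ⬝ᵥ w := by
    intro w
    simp [L, dotProduct]
  have hfun : (fun x => l ⬝ᵥ φ x) = L ∘ φ := funext fun x => (hL _).symm
  have han : AnalyticAt ℂ (L ∘ φ) 0 := (L.analyticAt _).comp hφ
  have hder : ∀ j (a : Fin j → Fin n → ℂ), iteratedFDeriv ℂ j (L ∘ φ) 0 a =
      l ⬝ᵥ iteratedFDeriv ℂ j φ 0 a := by
    intro j a
    rw [L.iteratedFDeriv_comp_left hφ.contDiffAt (i := j) (n := j) le_rfl,
      ContinuousLinearMap.compContinuousMultilinearMap_coe, Function.comp_apply, hL]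
  rw [hfun]
  constructor
  · intro h
    refine vanishesToOrder_of_iteratedFDeriv_eq_zero han fun j hj => ?_
    refine ContinuousMultilinearMap.toMultilinearMap_injective
      (Module.Basis.ext_multilinear (fun _ => Pi.basisFun ℂ (Fin n)) fun a => ?_)
    simp only [Pi.basisFun_apply, ContinuousMultilinearMap.coe_coe,
      ContinuousMultilinearMap.toMultilinearMap_zero, zero_apply]
    rw [hder]
    exact h _ (Submodule.subset_span ⟨j, hj, a, rfl⟩)
  · intro h w hw
    refine dotProduct_span ?_ hw
    rintro w ⟨j, hj, a, rfl⟩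
    rw [← hder]
    exact iteratedFDeriv_eq_zero_of_vanishesToOrder han h hj _

/-! ### Linear combinations of monomials vanishing at a coordinate point -/

section Low

variable {r : ℕ} {β : Fin r → Type} {d : Fin r → ℕ} [∀ i, DecidableEq (β i)]

/-- The number of entries of `K` different from the base entries `o`. -/
def offDegree (o : ∀ i, β i) (K : ∀ i, Sym (β i) (d i)) : ℕ :=
  ∑ i, ((K i : Multiset (β i)).filter (· ≠ o i)).card

/-- The exponent of the monomial `K` in the variables different from the base ones. -/
def offExponent (o : ∀ i, β i) (K : ∀ i, Sym (β i) (d i)) : (Σ i, β i) →₀ ℕ :=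
  ∑ i, ((K i : Multiset (β i)).map
    fun b => if b = o i then (0 : (Σ i, β i) →₀ ℕ) else Finsupp.single ⟨i, b⟩ 1).sum

theorem degree_offExponent (o : ∀ i, β i) (K : ∀ i, Sym (β i) (d i)) :
    (offExponent o K).degree = offDegree o K := by
  rw [offExponent, offDegree, map_sum]
  refine Finset.sum_congr rfl fun i _ => ?_
  generalize (K i : Multiset (β i)) = s
  induction s using Multiset.induction_on with
  | empty => simp
  | cons b s ih =>
    rw [Multiset.map_cons, Multiset.sum_cons, map_add, ih]
    by_cases hb : b = o i <;> simp [hb, add_comm]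

theorem offExponent_apply (o : ∀ i, β i) (K : ∀ i, Sym (β i) (d i)) (i : Fin r) (b : β i)
    (hb : b ≠ o i) : offExponent o K ⟨i, b⟩ = (K i : Multiset (β i)).count b := by
  rw [offExponent, Finsupp.finsetSum_apply, Finset.sum_eq_single i]
  · generalize (K i : Multiset (β i)) = s
    induction s using Multiset.induction_on with
    | empty => simp
    | cons c s ih =>
      rw [Multiset.map_cons, Multiset.sum_cons, Finsupp.add_apply, ih, Multiset.count_cons]
      by_cases hc : c = o i
      · rw [if_pos hc, if_neg (fun h => hb (h.trans hc))]
        simp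
      · rw [if_neg hc, Finsupp.single_apply]
        simp [add_comm, eq_comm]
  · intro j _ hj
    generalize (K j : Multiset (β j)) = s
    induction s using Multiset.induction_on with
    | empty => simp
    | cons c s ih =>
      rw [Multiset.map_cons, Multiset.sum_cons, Finsupp.add_apply, ih]
      split_ifs
      · simp
      · rw [Finsupp.single_apply, if_neg (fun h => hj (congrArg Sigma.fst h)), add_zero]
  · simp

/-- The exponent forgets the multiplicity of the base entry `o i`, but the total size `d i` restores
it. -/
theorem offExponent_injective (o : ∀ i, β i) :
    Function.Injective (offExponent o : (∀ i, Sym (β i) (d i)) → _) := by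
  intro K K' h
  funext i
  refine Subtype.ext (Multiset.ext.2 fun b => ?_)
  have h1 : ∀ b, b ≠ o i → (K i : Multiset (β i)).count b = (K' i : Multiset (β i)).count b := by
    intro b hb
    rw [← offExponent_apply o K i b hb, h, offExponent_apply o K' i b hb]
  by_cases hb : b = o i
  · have hf : (K i : Multiset (β i)).filter (· ≠ o i) = (K' i : Multiset (β i)).filter (· ≠ o i) := by
      ext b
      rw [Multiset.count_filter, Multiset.count_filter]
      split_ifs with hb
      exacts [h1 b hb, rfl]
    have e : ∀ K : Sym (β i) (d i), (K : Multiset (β i)).count (o i) +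
        ((K : Multiset (β i)).filter (· ≠ o i)).card = d i := by
      intro K
      refine Eq.trans ?_ K.2
      rw [Multiset.count_eq_card_filter_eq, ← Multiset.card_add,
        ← Multiset.filter_add_not (o i = ·) K.1]
      simp only [ne_comm, ne_eq, Sym.val_eq_coe]
    have e1 := e (K i)
    have e2 := e (K' i)
    rw [hf] at e1
    subst hb
    exact Nat.add_right_cancel (e1.trans e2.symm)
  · exact h1 b hb

theorem mon_off (o : ∀ i, β i) (K : ∀ i, Sym (β i) (d i)) :
    mon (fun i b => if b = o i then 1 else (MvPolynomial.X ⟨i, b⟩ : MvPolynomial (Σ i, β i) ℂ)) K =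
      MvPolynomial.monomial (offExponent o K) 1 := by
  rw [mon, offExponent, MvPolynomial.monomial_sum_one]
  refine Finset.prod_congr rfl fun i _ => ?_
  generalize (K i : Multiset (β i)) = s
  induction s using Multiset.induction_on with
  | empty => simp
  | cons b s ih =>
    rw [Multiset.map_cons, Multiset.prod_cons, ih, Multiset.map_cons, Multiset.sum_cons]
    split_ifs
    · rw [one_mul, zero_add]
    · rw [MvPolynomial.X, MvPolynomial.monomial_mul, one_mul]

/-- Dehomogenize by setting the base variables equal to `1`. Distinct monomials of multidegree `d`
stay distinct, and the degree of such a monomial becomes `offDegree`, so low order terms cannot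
cancel. -/
theorem coeff_eq_zero_of_vanishesToOrder [∀ i, Fintype (β i)] (o : ∀ i, β i)
    (c : (∀ i, Sym (β i) (d i)) → ℂ) (k : ℕ)
    (h : VanishesToOrder k (fun u : ∀ i, β i → ℂ => ∑ K, c K * mon u K)
      (fun i => Pi.single (o i) 1)) {K : ∀ i, Sym (β i) (d i)} (hK : offDegree o K < k) :
    c K = 0 := by
  let Q : MvPolynomial (Σ i, β i) ℂ := ∑ K, MvPolynomial.monomial (offExponent o K) (c K)
  have hQ : Q = ∑ K, MvPolynomial.C (c K) *
      mon (fun i b => if b = o i then 1 else MvPolynomial.X ⟨i, b⟩) K := by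
    simp only [mon_off, MvPolynomial.C_mul_monomial, mul_one, Q]
  have h1 : VanishesToOrder k (fun h => MvPolynomial.eval h Q) 0 := by
    refine h.transport (c := fun _ => 1)
      (g := fun (h : (Σ i, β i) → ℂ) i b => if b = o i then 1 else h ⟨i, b⟩) ?_ ?_
      continuousAt_const (Filter.Eventually.of_forall fun x => ?_)
    · refine differentiableAt_pi.2 fun i => differentiableAt_pi.2 fun b => ?_
      by_cases hb : b = o i
      · simp only [if_pos hb]
        fun_prop
      · simp only [if_neg hb]
        fun_prop
    · funext i b
      simp [Pi.single_apply]
    · simp only [hQ, map_sum, map_mul, MvPolynomial.eval_C, one_mul]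
      refine Finset.sum_congr rfl fun K _ => ?_
      rw [map_mon (MvPolynomial.eval x)]
      congr 2
      funext i b
      split_ifs <;> simp
  have h2 := (vanishesToOrder_eval_iff Q k).1 h1 (offExponent o K)
    (by rwa [degree_offExponent])
  rw [MvPolynomial.coeff_sum, Finset.sum_eq_single K] at h2
  · simpa using h2
  · intro K' _ hne
    rw [MvPolynomial.coeff_monomial, if_neg fun he => hne (offExponent_injective o he)]
  · simp

end Low

/-! ### Taylor coefficients of the monomial map -/

section Jet

variable {r : ℕ} {β : Fin r → Type} {d : Fin r → ℕ}

/-- The vector of coefficients at `α` of the Taylor expansions at `v` of the monomials. -/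
def jetCoeff {R : Type*} [CommSemiring R] (v : ∀ i, β i → R) (α : (Σ i, β i) →₀ ℕ)
    (K : ∀ i, Sym (β i) (d i)) : R :=
  (mon (fun i b => MvPolynomial.C (v i b) + MvPolynomial.X (⟨i, b⟩ : Σ i, β i)) K).coeff α

theorem map_jetCoeff {R S : Type*} [CommSemiring R] [CommSemiring S] (f : R →+* S)
    (v : ∀ i, β i → R) (α : (Σ i, β i) →₀ ℕ) (K : ∀ i, Sym (β i) (d i)) :
    f (jetCoeff v α K) = jetCoeff (fun i b => f (v i b)) α K := by
  rw [jetCoeff, ← MvPolynomial.coeff_map, map_mon]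
  simp only [map_add, MvPolynomial.map_C, MvPolynomial.map_X, jetCoeff]

variable [∀ i, Fintype (β i)] [∀ i, DecidableEq (β i)]

/-- The numbers `l ⬝ᵥ jetCoeff v α` are the coefficients of the polynomial obtained by translating
`v` to the origin. -/
theorem vanishesToOrder_mon_iff (l : (∀ i, Sym (β i) (d i)) → ℂ) (v : ∀ i, β i → ℂ) (k : ℕ) :
    VanishesToOrder k (fun u => l ⬝ᵥ mon u) v ↔
      ∀ α : (Σ i, β i) →₀ ℕ, α.degree < k → l ⬝ᵥ jetCoeff v α = 0 := by
  let Q : MvPolynomial (Σ i, β i) ℂ := ∑ K, MvPolynomial.C (l K) *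
    mon (fun i b => MvPolynomial.C (v i b) + MvPolynomial.X (⟨i, b⟩ : Σ i, β i)) K
  have hcoeff : ∀ α, Q.coeff α = l ⬝ᵥ jetCoeff v α := by
    intro α
    simp only [Q, MvPolynomial.coeff_sum, MvPolynomial.coeff_C_mul, dotProduct, jetCoeff]
  have heval : ∀ h, MvPolynomial.eval h Q = l ⬝ᵥ mon (fun i b => v i b + h ⟨i, b⟩) := by
    intro h
    simp only [Q, map_sum, map_mul, MvPolynomial.eval_C, dotProduct, map_mon, map_add,
      MvPolynomial.eval_X]
  simp only [← hcoeff]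
  rw [← vanishesToOrder_eval_iff]
  constructor
  · intro h
    refine h.transport (c := fun _ => 1)
      (g := fun (h : (Σ i, β i) → ℂ) i b => v i b + h ⟨i, b⟩) (by fun_prop) (by simp)
      continuousAt_const (Filter.Eventually.of_forall fun x => ?_)
    simp only [heval, one_mul]
  · intro h
    refine h.transport (c := fun _ => 1)
      (g := fun (u : ∀ i, β i → ℂ) (x : Σ i, β i) => u x.1 x.2 - v x.1 x.2) (by fun_prop) ?_
      continuousAt_const (Filter.Eventually.of_forall fun x => ?_)
    · funext x
      simp
    · simp only [heval, one_mul, add_sub_cancel]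

end Jet

/-! ### Affine charts of Segre-Veronese varieties -/

section Chart

variable {r : ℕ} {β : Fin r → Type} {d : Fin r → ℕ}

/-- The monomial `∏ x_{i, a_i}^{d_i}`. -/
def baseIndex (a : ∀ i, β i) : ∀ i, Sym (β i) (d i) := fun i => Sym.replicate (d i) (a i)

/-- The monomial `∏ x_{i, a_i}^{d_i}` with one factor `x_{i, a_i}` replaced by `x_{i, b}`. -/
def neighbourIndex (hd : ∀ i, 0 < d i) (a : ∀ i, β i) (i : Fin r) (b : β i) :
    ∀ i, Sym (β i) (d i) :=
  Function.update (baseIndex a) i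
    (Sym.mk (b ::ₘ Multiset.replicate (d i - 1) (a i)) (by
      rw [Multiset.card_cons, Multiset.card_replicate]; exact Nat.sub_add_cancel (hd i)))

variable {R : Type*} [CommSemiring R]

theorem mon_baseIndex (a : ∀ i, β i) (u : ∀ i, β i → R) :
    mon u (baseIndex a : ∀ i, Sym (β i) (d i)) = ∏ i, u i (a i) ^ d i := by
  simp [mon, baseIndex, Sym.coe_replicate]

theorem mon_neighbourIndex (hd : ∀ i, 0 < d i) (a : ∀ i, β i) (u : ∀ i, β i → R) (i : Fin r)
    (b : β i) : mon u (neighbourIndex hd a i b) =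
      u i b * (u i (a i) ^ (d i - 1) * ∏ j ∈ {i}ᶜ, u j (a j) ^ d j) := by
  rw [mon, Fintype.prod_eq_mul_prod_compl i, ← mul_assoc]
  congr 1
  · rw [neighbourIndex, Function.update_self, Sym.coe_mk, Multiset.map_cons, Multiset.prod_cons,
      Multiset.map_replicate, Multiset.prod_replicate]
  · refine Finset.prod_congr rfl fun j hj => ?_
    have hj : j ≠ i := by simpa using hj
    rw [neighbourIndex, Function.update_of_ne hj, baseIndex, Sym.coe_replicate,
      Multiset.map_replicate, Multiset.prod_replicate]

theorem mon_neighbourIndex_mul (hd : ∀ i, 0 < d i) (a : ∀ i, β i) (u : ∀ i, β i → R) (i : Fin r)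
    (b : β i) : mon u (neighbourIndex hd a i b) * u i (a i) =
      mon u (baseIndex a : ∀ i, Sym (β i) (d i)) * u i b := by
  rw [mon_neighbourIndex, mon_baseIndex, Fintype.prod_eq_mul_prod_compl i,
    ← pow_sub_one_mul (hd i).ne' (u i (a i))]
  ring

/-- Ratios of ambient coordinates recover the affine coordinates of each factor, so these ratios
invert the affine chart of the embedding. -/
theorem neighbour_div_base (hd : ∀ i, 0 < d i) (a : ∀ i, β i) {u : ∀ i, β i → ℂ} {c : ℂ}
    {w : (∀ i, Sym (β i) (d i)) → ℂ} (hw : w = c • mon u) (h0 : w (baseIndex a) ≠ 0)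
    (i : Fin r) (b : β i) :
    u i (a i) ≠ 0 ∧ w (neighbourIndex hd a i b) / w (baseIndex a) = u i b / u i (a i) := by
  subst hw
  rw [Pi.smul_apply, smul_eq_mul] at h0
  have hc := left_ne_zero_of_mul h0
  have hm := right_ne_zero_of_mul h0
  have hu : u i (a i) ≠ 0 := by
    rw [mon_baseIndex, Finset.prod_ne_zero_iff] at hm
    exact ne_zero_pow (hd i).ne' (hm i (Finset.mem_univ i))
  refine ⟨hu, ?_⟩
  simp only [Pi.smul_apply, smul_eq_mul]
  rw [mul_div_mul_left _ _ hc, div_eq_div_iff hm hu, mon_neighbourIndex_mul, mul_comm]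

theorem mon_eq_smul_mon_div (a : ∀ i, β i) {u : ∀ i, β i → ℂ} (hu : ∀ i, u i (a i) ≠ 0) :
    (mon u : (∀ i, Sym (β i) (d i)) → ℂ) =
      mon u (baseIndex a : ∀ i, Sym (β i) (d i)) • mon fun i b => u i b / u i (a i) := by
  funext K
  rw [mon_baseIndex, Pi.smul_apply, smul_eq_mul, ← mon_smul]
  congr 1
  funext i b
  rw [Pi.smul_apply, smul_eq_mul, mul_div_cancel₀ _ (hu i)]

theorem eq_smul_mon_neighbour_div_base (hd : ∀ i, 0 < d i) (a : ∀ i, β i) {u : ∀ i, β i → ℂ}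
    {c : ℂ} {w : (∀ i, Sym (β i) (d i)) → ℂ} (hw : w = c • mon u) (h0 : w (baseIndex a) ≠ 0) :
    w = w (baseIndex a) • mon fun i b => w (neighbourIndex hd a i b) / w (baseIndex a) := by
  have h := neighbour_div_base hd a hw h0
  have hm := mon_eq_smul_mon_div (d := d) a fun i => (h i (a i)).1
  simp only [fun i b => (h i b).2]
  subst hw
  conv_lhs => rw [hm]
  rw [Pi.smul_apply, smul_smul, smul_eq_mul]

end Chart

/-! ### Osculating spaces of the Segre-Veronese variety. -/

section Variety

variable {r : ℕ} {n d : Fin r → ℕ}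

theorem ne_zero_of_monomialMap_ne_zero (hd : ∀ i, 0 < d i) {v : ∀ i, Fin (n i + 1) → ℂ}
    (h : monomialMap n d v ≠ 0) (i : Fin r) : v i ≠ 0 := by
  rintro hi
  refine h (funext fun K => ?_)
  choose κ hκ using fun i => symOfFun_surjective (K i)
  obtain rfl : (fun i => symOfFun (κ i)) = K := funext hκ
  rw [monomialMap_eq_mon, mon_symOfFun]
  exact Finset.prod_eq_zero (Finset.mem_univ i)
    (Finset.prod_eq_zero (Finset.mem_univ ⟨0, hd i⟩) (by simp [hi]))

theorem mk_monomialMap_mem_variety (hd : ∀ i, 0 < d i) {v : ∀ i, Fin (n i + 1) → ℂ}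
    (h : monomialMap n d v ≠ 0) : Projectivization.mk ℂ (monomialMap n d v) h ∈ variety n d := by
  have hv := ne_zero_of_monomialMap_ne_zero hd h
  refine ⟨fun i => Projectivization.mk ℂ (v i) (hv i), ?_⟩
  rw [embedding, Projectivization.mk_eq_mk_iff']
  choose c hc using fun i => Projectivization.exists_smul_eq_mk_rep ℂ (v i) (hv i)
  refine ⟨∏ i, (c i : ℂ) ^ d i, ?_⟩
  funext K
  simp only [← hc]
  rw [Pi.smul_apply, smul_eq_mul, monomialMap_eq_mon, monomialMap_eq_mon]
  exact (mon_smul (fun i => (c i : ℂ)) v K).symm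

theorem exists_eq_smul_of_mk_mem_variety {w : Index n d → ℂ} {h : w ≠ 0}
    (hw : Projectivization.mk ℂ w h ∈ variety n d) :
    ∃ (c : ℂ) (u : ∀ i, Fin (n i + 1) → ℂ), w = c • (mon u : Index n d → ℂ) := by
  obtain ⟨x, hx⟩ := hw
  rw [embedding, Projectivization.mk_eq_mk_iff'] at hx
  obtain ⟨c, hc⟩ := hx
  have hc0 : c ≠ 0 := by
    rintro rfl
    rw [zero_smul] at hc
    exact monomialMap_ne_zero n d _ (fun i => (x i).rep_nonzero) hc.symm
  exact ⟨c⁻¹, fun i => (x i).rep, by rw [← monomialMap_eq_mon, ← hc, inv_smul_smul₀ hc0]⟩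

/-- Here `φ` is arbitrary, so the supremum in `osculatingSpace` gets bounded from above. Near `0`,
`φ` is a continuous multiple of `mon ∘ g`, where `g` lifts `φ` to the multicone by ratios of
coordinates; the order of vanishing then passes from `v` to `0`. -/
theorem jetSpan_annihilator_of_vanishesToOrder (hd : ∀ i, 0 < d i) {v : ∀ i, Fin (n i + 1) → ℂ}
    (hv : monomialMap n d v ≠ 0) {i₀ : Index n d} {N : ℕ} {φ : (Fin N → ℂ) → (Index n d → ℂ)}
    (hφ : IsLocalParametrization (variety n d) (Projectivization.mk ℂ _ hv) i₀ φ) {k : ℕ}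
    {l : Index n d → ℂ} (hl : VanishesToOrder (k + 1) (fun u => l ⬝ᵥ mon u) v) :
    ∀ w ∈ jetSpan φ k, l ⬝ᵥ w = 0 := by
  rw [jetSpan_annihilator_iff hφ.analyticAt]
  choose a ha using fun i => Function.ne_iff.1 (ne_zero_of_monomialMap_ne_zero hd hv i)
  simp only [Pi.zero_apply] at ha
  obtain ⟨c, hc⟩ : ∃ c : ℂ, φ 0 = c • (mon v : Index n d → ℂ) := by
    obtain ⟨h0, hb⟩ := hφ.base
    obtain ⟨c, hc⟩ := (Projectivization.mk_eq_mk_iff' ℂ _ _ _ _).1 hb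
    exact ⟨c, hc.symm⟩
  have hmv : mon v (baseIndex a : Index n d) ≠ 0 := by
    rw [mon_baseIndex]
    exact Finset.prod_ne_zero_iff.2 fun i _ => pow_ne_zero _ (ha i)
  have hc0 : c ≠ 0 := by
    rintro rfl
    rw [zero_smul] at hc
    exact hφ.base.choose hc
  have hb0 : φ 0 (baseIndex a) ≠ 0 := by
    rw [hc]
    exact mul_ne_zero hc0 hmv
  have hdiff : ∀ K, DifferentiableAt ℂ (fun x => φ x K) 0 :=
    differentiableAt_pi.1 hφ.analyticAt.differentiableAt
  have hmem : ∀ᶠ x in 𝓝 0, φ x ∈ affinePart (variety n d) i₀ := by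
    have h1 : affinePart (variety n d) i₀ ∈ 𝓝[affinePart (variety n d) i₀] (φ 0) :=
      self_mem_nhdsWithin
    rw [← hφ.map_nhds] at h1
    exact h1
  have hne : ∀ᶠ x in 𝓝 0, φ x (baseIndex a) ≠ 0 :=
    (hdiff _).continuousAt.eventually_ne hb0
  -- The factor `v i (a i)` makes the lift pass through `v` itself at `x = 0`; the scalar `c`
  -- compensates for it.
  refine hl.transport (c := fun x => φ x (baseIndex a) / mon v (baseIndex a : Index n d))
    (g := fun x i b => v i (a i) * (φ x (neighbourIndex hd a i b) / φ x (baseIndex a)))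
    ?_ ?_ ?_ ?_
  · refine differentiableAt_pi.2 fun i => differentiableAt_pi.2 fun b => ?_
    simp only [div_eq_mul_inv]
    exact ((hdiff _).mul ((hdiff _).inv hb0)).const_mul _
  · funext i b
    rw [(neighbour_div_base hd a hc hb0 i b).2, mul_div_cancel₀ _ (ha i)]
  · exact (hdiff _).continuousAt.div_const _
  · filter_upwards [hmem, hne] with x hx hx0
    obtain ⟨-, h0, hX⟩ := hx
    obtain ⟨c, u, hu⟩ := exists_eq_smul_of_mk_mem_variety hX
    have h1 : (mon fun i b => v i (a i) *
        (φ x (neighbourIndex hd a i b) / φ x (baseIndex a)) : Index n d → ℂ) =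
        mon v (baseIndex a : Index n d) •
          mon fun i b => φ x (neighbourIndex hd a i b) / φ x (baseIndex a) := by
      funext K
      rw [mon_baseIndex, Pi.smul_apply, smul_eq_mul, ← mon_smul]
      rfl
    rw [h1, dotProduct_smul, smul_eq_mul, ← mul_assoc, div_mul_cancel₀ _ hmv, ← smul_eq_mul,
      ← dotProduct_smul, ← eq_smul_mon_neighbour_div_base hd a hu hx0]

/-- The affine left inverse gives both properties at once: differentiating it gives immersivity, and
its continuity makes `φ` an embedding onto the affine part. -/
theorem isLocalParametrization_of_affine_leftInverse {ι : Type} [Fintype ι]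
    {X : Set (ℙ ℂ (ι → ℂ))} {p : ℙ ℂ (ι → ℂ)} {i₀ : ι} {N : ℕ} {φ : (Fin N → ℂ) → (ι → ℂ)}
    (hφ : ∀ y, AnalyticAt ℂ φ y) (hrange : Set.range φ = affinePart X i₀)
    (hbase : ∃ h : φ 0 ≠ 0, Projectivization.mk ℂ (φ 0) h = p)
    (L : (ι → ℂ) →L[ℂ] (Fin N → ℂ)) (c : Fin N → ℂ) (hL : ∀ y, L (φ y) = c + y) :
    IsLocalParametrization X p i₀ φ where
  analyticAt := hφ 0
  immersive := by
    have h1 : HasFDerivAt (fun y => L (φ y)) (L.comp (fderiv ℂ φ 0)) 0 :=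
      L.hasFDerivAt.comp 0 (hφ 0).differentiableAt.hasFDerivAt
    have h2 : HasFDerivAt (fun y => L (φ y)) (ContinuousLinearMap.id ℂ (Fin N → ℂ)) 0 := by
      simp only [hL]
      exact (hasFDerivAt_id 0).const_add c
    intro x y hxy
    have h3 := h1.unique h2
    have h4 : ∀ z, L (fderiv ℂ φ 0 z) = z := fun z => congrArg (fun f => f z) h3
    rw [← h4 x, ← h4 y, hxy]
  mem := hrange ▸ Set.mem_range_self 0
  base := hbase
  map_nhds := by
    have hinv : Function.LeftInverse (fun w => L w - c) φ := fun y => by simp [hL]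
    have hemb := hinv.isEmbedding (by fun_prop)
      (continuous_iff_continuousAt.2 fun y => (hφ y).continuousAt)
    rw [← hrange]
    exact hemb.toIsInducing.map_nhds_eq 0

/-- The standard chart `u i (a i) = 1`, centred at `v`. Conversely to the bound valid for every
parametrization, `mon u` is a multiple of `φ` at the affine coordinates of `u`, so vanishing along
this `φ` gives vanishing on the multicone. -/
theorem exists_isLocalParametrization_variety (hd : ∀ i, 0 < d i) {v : ∀ i, Fin (n i + 1) → ℂ}
    (hv : monomialMap n d v ≠ 0) :
    ∃ (N : ℕ) (i₀ : Index n d) (φ : (Fin N → ℂ) → (Index n d → ℂ)),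
      IsLocalParametrization (variety n d) (Projectivization.mk ℂ _ hv) i₀ φ ∧
      ∀ (k : ℕ) (l : Index n d → ℂ), (∀ w ∈ jetSpan φ k, l ⬝ᵥ w = 0) →
        VanishesToOrder (k + 1) (fun u => l ⬝ᵥ mon u) v := by
  choose a ha using fun i => Function.ne_iff.1 (ne_zero_of_monomialMap_ne_zero hd hv i)
  simp only [Pi.zero_apply] at ha
  obtain ⟨N, ⟨e⟩⟩ : ∃ N, Nonempty (Fin N ≃ {x : Σ i, Fin (n i + 1) // x.2 ≠ a x.1}) :=
    ⟨_, ⟨(Fintype.equivFin _).symm⟩⟩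
  let U : (Fin N → ℂ) → ∀ i, Fin (n i + 1) → ℂ := fun y i b =>
    if h : b = a i then 1 else v i b / v i (a i) + y (e.symm ⟨⟨i, b⟩, h⟩)
  let φ : (Fin N → ℂ) → Index n d → ℂ := fun y => mon (U y)
  have hUa : ∀ y i, U y i (a i) = 1 := fun y i => dif_pos rfl
  have hUq : ∀ q : ∀ i, Fin (n i + 1) → ℂ, (∀ i, q i (a i) = 1) →
      U (fun z => q (e z).1.1 (e z).1.2 - v (e z).1.1 (e z).1.2 / v (e z).1.1 (a (e z).1.1)) =
        q := by
    intro q hq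
    funext i b
    by_cases h : b = a i
    · subst h
      exact (dif_pos rfl).trans (hq i).symm
    · simp only [U, dif_neg h]
      rw [Equiv.apply_symm_apply, add_sub_cancel]
  have hU0 : ∀ y i, U y i ≠ 0 := fun y i h => by
    have := congrFun h (a i)
    rw [hUa] at this
    exact one_ne_zero this
  have hφb : ∀ y, φ y (baseIndex a) = 1 := by
    intro y
    simp only [φ, mon_baseIndex, hUa, one_pow, Finset.prod_const_one]
  have hφn : ∀ y i b, φ y (neighbourIndex hd a i b) = U y i b := by
    intro y i b
    have := mon_neighbourIndex_mul hd a (U y) i b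
    rw [hUa, mul_one] at this
    exact this.trans (by rw [show mon (U y) (baseIndex a) = 1 from hφb y, one_mul])
  have hUan : ∀ y i b, AnalyticAt ℂ (fun y => U y i b) y := by
    intro y i b
    by_cases h : b = a i
    · simp only [U, dif_pos h]
      exact analyticAt_const
    · simp only [U, dif_neg h]
      exact analyticAt_const.add ((ContinuousLinearMap.proj (R := ℂ)
        (φ := fun _ : Fin N => ℂ) (e.symm ⟨⟨i, b⟩, h⟩)).analyticAt y)
  have hφan : ∀ y, AnalyticAt ℂ φ y := by
    intro y
    refine AnalyticAt.pi fun K => ?_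
    choose κ hκ using fun i => symOfFun_surjective (K i)
    obtain rfl : (fun i => symOfFun (κ i)) = K := funext hκ
    simp only [mon_symOfFun]
    exact Finset.analyticAt_fun_prod _ fun i _ => Finset.analyticAt_fun_prod _ fun q _ =>
      hUan y i _
  have hrange : Set.range φ = affinePart (variety n d) (baseIndex a) := by
    ext w
    constructor
    · rintro ⟨y, rfl⟩
      exact ⟨hφb y, monomialMap_ne_zero n d _ (hU0 y), mk_monomialMap_mem_variety hd _⟩
    · rintro ⟨hw1, hw0, hX⟩
      obtain ⟨c, u, hu⟩ := exists_eq_smul_of_mk_mem_variety hX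
      have hwb : w (baseIndex a) ≠ 0 := by rw [hw1]; exact one_ne_zero
      have h1 := eq_smul_mon_neighbour_div_base hd a hu hwb
      have h2 := neighbour_div_base hd a hu hwb
      rw [hw1, one_smul] at h1
      refine ⟨fun z => w (neighbourIndex hd a (e z).1.1 (e z).1.2) -
        v (e z).1.1 (e z).1.2 / v (e z).1.1 (a (e z).1.1), ?_⟩
      conv_rhs => rw [h1]
      simp only [φ, div_one]
      rw [hUq fun i b => w (neighbourIndex hd a i b)]
      intro i
      rw [← div_one (w _), ← hw1, (h2 i (a i)).2, div_self (h2 i (a i)).1, hw1]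
  have hUzero : ∀ i b, U 0 i b = v i b / v i (a i) := by
    intro i b
    by_cases h : b = a i
    · subst h
      rw [hUa, div_self (ha i)]
    · simp only [U, dif_neg h, Pi.zero_apply, add_zero]
  have hmv : (mon v : Index n d → ℂ) = mon v (baseIndex a : Index n d) • φ 0 := by
    rw [mon_eq_smul_mon_div a ha]
    simp only [φ, Pi.smul_apply, smul_eq_mul]
    congr 1
    · simp [mon_baseIndex, div_self (ha _)]
    · congr 1
      funext i b
      rw [hUzero]
  have hbase : ∃ h : φ 0 ≠ 0,
      Projectivization.mk ℂ (φ 0) h = Projectivization.mk ℂ (monomialMap n d v) hv := by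
    refine ⟨monomialMap_ne_zero n d _ (hU0 0), ?_⟩
    refine Eq.symm ((Projectivization.mk_eq_mk_iff' ℂ _ _ _ _).2
      ⟨mon v (baseIndex a : Index n d), hmv.symm⟩)
  let L : (Index n d → ℂ) →L[ℂ] (Fin N → ℂ) :=
    ContinuousLinearMap.pi fun z =>
      ContinuousLinearMap.proj (neighbourIndex hd a (e z).1.1 (e z).1.2)
  refine ⟨_, baseIndex a, φ, isLocalParametrization_of_affine_leftInverse hφan hrange hbase L
    (fun z => v (e z).1.1 (e z).1.2 / v (e z).1.1 (a (e z).1.1)) (fun y => ?_), fun k l hl => ?_⟩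
  · funext z
    simp only [L, ContinuousLinearMap.coe_pi', ContinuousLinearMap.proj_apply, hφn, Pi.add_apply]
    have h := (e z).2
    simp only [U, dif_neg h]
    congr 2
    exact e.symm_apply_apply z
  · rw [jetSpan_annihilator_iff (hφan 0)] at hl
    have hcoord : ∀ i b, DifferentiableAt ℂ (fun u : ∀ i, Fin (n i + 1) → ℂ => u i b) v :=
      fun i b => by fun_prop
    refine hl.transport (c := fun u => mon u (baseIndex a : Index n d))
      (g := fun u z => u (e z).1.1 (e z).1.2 / u (e z).1.1 (a (e z).1.1) -
        v (e z).1.1 (e z).1.2 / v (e z).1.1 (a (e z).1.1)) ?_ ?_ ?_ ?_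
    · simp only [div_eq_mul_inv]
      exact differentiableAt_pi.2 fun z => ((hcoord _ _).mul ((hcoord _ _).inv (ha _))).sub_const _
    · funext z
      simp
    · simp only [mon_baseIndex]
      exact tendsto_finsetProd _ fun i _ => ((hcoord i (a i)).continuousAt.pow _)
    · have hne : ∀ᶠ u in 𝓝 v, ∀ i, u i (a i) ≠ 0 :=
        Filter.eventually_all.2 fun i => (hcoord i (a i)).continuousAt.eventually_ne (ha i)
      filter_upwards [hne] with u hu
      rw [← smul_eq_mul, ← dotProduct_smul]
      conv_lhs => rw [mon_eq_smul_mon_div a hu]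
      simp only [φ]
      rw [hUq (fun i b => u i b / u i (a i)) fun i => div_self (hu i)]

theorem osculatingSpace_variety (hd : ∀ i, 0 < d i) {v : ∀ i, Fin (n i + 1) → ℂ}
    (hv : monomialMap n d v ≠ 0) (k : ℕ) :
    osculatingSpace (variety n d) (Projectivization.mk ℂ _ hv) k =
      Submodule.span ℂ {w | ∃ α : (Σ i, Fin (n i + 1)) →₀ ℕ, α.degree ≤ k ∧ w = jetCoeff v α} := by
  refine le_antisymm ?_ ?_
  · refine iSup_le fun N => iSup_le fun i₀ => iSup_le fun φ => iSup_le fun hφ => ?_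
    refine span_le_of_dotProduct fun l hl w hw => ?_
    refine jetSpan_annihilator_of_vanishesToOrder hd hv hφ (k := k) ?_ w
      (Submodule.subset_span hw)
    exact (vanishesToOrder_mon_iff l v (k + 1)).2 fun α hα =>
      hl _ (Submodule.subset_span ⟨α, Nat.lt_succ_iff.1 hα, rfl⟩)
  · obtain ⟨N, i₀, φ, hφ, hφk⟩ := exists_isLocalParametrization_variety hd hv
    have hle : jetSpan φ k ≤ osculatingSpace (variety n d) (Projectivization.mk ℂ _ hv) k :=
      le_iSup_of_le N (le_iSup_of_le i₀ (le_iSup_of_le φ (le_iSup_of_le hφ le_rfl)))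
    refine (span_le_of_dotProduct fun l hl w hw => ?_).trans hle
    obtain ⟨α, hα, rfl⟩ := hw
    exact (vanishesToOrder_mon_iff l v (k + 1)).1 (hφk k l hl) α (Nat.lt_succ_iff.2 hα)

end Variety

/-! ### The projective line -/

/-- The homogeneous form of degree `e` in `X 0`, `X 1` with the coefficients of `p`. -/
def binaryForm (e : ℕ) (p : Polynomial ℂ) : MvPolynomial (Fin 2) ℂ :=
  ∑ l ∈ Finset.range (e + 1),
    MvPolynomial.C (p.coeff l) * (MvPolynomial.X 0 ^ (e - l) * MvPolynomial.X 1 ^ l)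

theorem isHomogeneous_binaryForm (e : ℕ) (p : Polynomial ℂ) : (binaryForm e p).IsHomogeneous e := by
  refine MvPolynomial.IsHomogeneous.sum _ _ _ fun l hl => ?_
  have h := (MvPolynomial.isHomogeneous_C (Fin 2) (p.coeff l)).mul
    (((MvPolynomial.isHomogeneous_X ℂ (0 : Fin 2)).pow (e - l)).mul
      ((MvPolynomial.isHomogeneous_X ℂ (1 : Fin 2)).pow l))
  convert h using 1
  have := Finset.mem_range_succ_iff.1 hl
  omega

theorem eval_binaryForm (e : ℕ) (p : Polynomial ℂ) (w : Fin 2 → ℂ) :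
    MvPolynomial.eval w (binaryForm e p) =
      ∑ l ∈ Finset.range (e + 1), p.coeff l * (w 0 ^ (e - l) * w 1 ^ l) := by
  simp [binaryForm]

theorem eval_binaryForm_of_ne_zero {e : ℕ} {p : Polynomial ℂ} (hp : p.natDegree ≤ e)
    {w : Fin 2 → ℂ} (hw : w 0 ≠ 0) :
    MvPolynomial.eval w (binaryForm e p) = w 0 ^ e * p.eval (w 1 / w 0) := by
  rw [eval_binaryForm, Polynomial.eval_eq_sum_range' (Nat.lt_succ_of_le hp), Finset.mul_sum]
  refine Finset.sum_congr rfl fun l hl => ?_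
  obtain ⟨m, rfl⟩ := Nat.exists_eq_add_of_le (Finset.mem_range_succ_iff.1 hl)
  rw [Nat.add_sub_cancel_left, pow_add, div_pow]
  field_simp

theorem isZariskiClosed_zeroLocus {ι : Type} {f : MvPolynomial ι ℂ} {e : ℕ}
    (hf : f.IsHomogeneous e) : IsZariskiClosed {p | MvPolynomial.eval p.rep f = 0} :=
  ⟨{f}, by rintro g rfl; exact ⟨e, hf⟩, by simp⟩

theorem rep_pointZero : pointZero.rep 0 ≠ 0 ∧ pointZero.rep 1 = 0 := by
  obtain ⟨c, hc⟩ := Projectivization.exists_smul_eq_mk_rep ℂ ![(1 : ℂ), 0] (by simp)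
  have h : pointZero.rep = c • ![(1 : ℂ), 0] := hc.symm
  simp [h, Units.smul_def]

theorem eq_pointZero_of_rep {x : ℙ ℂ (Fin 2 → ℂ)} (h : x.rep 1 = 0) : x = pointZero := by
  rw [← x.mk_rep, pointZero, Projectivization.mk_eq_mk_iff']
  refine ⟨x.rep 0, ?_⟩
  funext i
  fin_cases i <;> simp [h]

/-! ### Flat limits of families spanned by polynomial vectors -/

/-- Constant vectors are `ℂ[T]`-combinations of the basis; evaluating these shows that the values at
`τ` span, and their number is the dimension. -/
theorem linearIndependent_eval_basis {ι : Type} [Fintype ι]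
    (B : Module.Basis ι (Polynomial ℂ) (ι → Polynomial ℂ)) (τ : ℂ) :
    LinearIndependent ℂ fun j i => (B j i).eval τ := by
  refine linearIndependent_of_top_le_span_of_card_eq_finrank (fun w _ => ?_) (by simp)
  have h := B.sum_repr fun i => Polynomial.C (w i)
  have hw : w = ∑ j, (B.repr (fun i => Polynomial.C (w i)) j).eval τ • fun i => (B j i).eval τ := by
    funext i
    have := congrArg (Polynomial.eval τ) (congrFun h i)
    rw [Polynomial.eval_C] at this
    conv_lhs => rw [← this]
    simp [Polynomial.eval_finsetSum]
  rw [hw]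
  exact Submodule.sum_mem _ fun j _ => Submodule.smul_mem _ _ (Submodule.subset_span ⟨j, rfl⟩)

theorem eval_mem_span_of_mem_span {ι A : Type*} {g : A → ι → Polynomial ℂ} {w : ι → Polynomial ℂ}
    (hw : w ∈ Submodule.span (Polynomial ℂ) (Set.range g)) (τ : ℂ) :
    (fun i => (w i).eval τ) ∈ Submodule.span ℂ (Set.range fun a i => (g a i).eval τ) := by
  induction hw using Submodule.span_induction with
  | mem w hw =>
    obtain ⟨a, rfl⟩ := hw
    exact Submodule.subset_span ⟨a, rfl⟩
  | zero =>
    convert Submodule.zero_mem _ using 1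
    funext i
    simp
  | add x y _ _ hx hy =>
    convert Submodule.add_mem _ hx hy using 1
    funext i
    simp
  | smul a x _ hx =>
    convert Submodule.smul_mem _ (a.eval τ) hx using 1
    funext i
    simp

/-- Smith normal form over the principal ideal domain `ℂ[T]` gives part of a basis `b j` of the
ambient module such that the multiples `a j • b j` form a basis of the span of `g`. The values of
the `b j` are independent for every `τ` and span the family wherever no `a j` vanishes, so their
values at `0` span the limit. A functional killing `g` kills `a j • b j`, hence `b j`, since `ℂ[T]`
is a domain. -/
theorem exists_isFlatLimit {ι : Type} [Fintype ι] {A : Type*} (g : A → ι → Polynomial ℂ)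
    (T : ℙ ℂ (Fin 2 → ℂ) → Submodule ℂ (ι → ℂ))
    (hT : ∀ x : ℙ ℂ (Fin 2 → ℂ), x.rep 0 ≠ 0 →
      T x = Submodule.span ℂ (Set.range fun a i => (g a i).eval (x.rep 1 / x.rep 0))) :
    ∃ T₀, IsFlatLimit Set.univ pointZero T T₀ ∧
      ∀ l : ι → Polynomial ℂ, (∀ a, l ⬝ᵥ g a = 0) →
        ∀ w ∈ T₀, (fun i => (l i).eval 0) ⬝ᵥ w = 0 := by
  classical
  obtain ⟨D, S⟩ := Submodule.smithNormalForm (Pi.basisFun (Polynomial ℂ) ι)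
    (Submodule.span (Polynomial ℂ) (Set.range g))
  let b : Fin D → ι → Polynomial ℂ := fun j => S.bM (S.f j)
  have hsnf : ∀ j, S.a j • b j ∈ Submodule.span (Polynomial ℂ) (Set.range g) := fun j => by
    rw [← S.snf j]
    exact (S.bN j).2
  have ha : ∀ j, S.a j ≠ 0 := by
    intro j hj
    have := S.snf j
    rw [hj, zero_smul] at this
    exact S.bN.ne_zero j (Subtype.ext this)
  have hspan : Submodule.span (Polynomial ℂ) (Set.range g) ≤
      Submodule.span (Polynomial ℂ) (Set.range b) := by
    intro w hw
    have h := congrArg Subtype.val (S.bN.sum_repr ⟨w, hw⟩)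
    rw [AddSubmonoidClass.coe_finsetSum] at h
    rw [← show _ = w from h]
    refine Submodule.sum_mem _ fun j _ => ?_
    rw [Submodule.coe_smul, S.snf j]
    exact Submodule.smul_mem _ _ (Submodule.smul_mem _ _ (Submodule.subset_span ⟨j, rfl⟩))
  have hbind : ∀ τ : ℂ, LinearIndependent ℂ fun j i => (b j i).eval τ := fun τ =>
    (linearIndependent_eval_basis S.bM τ).comp S.f S.f.injective
  have hbspan : ∀ τ : ℂ, (∀ j, (S.a j).eval τ ≠ 0) →
      Submodule.span ℂ (Set.range fun a i => (g a i).eval τ) =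
        Submodule.span ℂ (Set.range fun j i => (b j i).eval τ) := by
    intro τ hτ
    refine le_antisymm (Submodule.span_le.2 ?_) (Submodule.span_le.2 ?_)
    · rintro _ ⟨a, rfl⟩
      exact eval_mem_span_of_mem_span (hspan (Submodule.subset_span ⟨a, rfl⟩)) τ
    · rintro _ ⟨j, rfl⟩
      have h := Submodule.smul_mem _ ((S.a j).eval τ)⁻¹ (eval_mem_span_of_mem_span (hsnf j) τ)
      have h' : (fun i => (b j i).eval τ) =
          ((S.a j).eval τ)⁻¹ • fun i => ((S.a j • b j) i).eval τ := by
        funext i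
        simp [hτ j]
      rw [← h'] at h
      exact h
  let e : Fin D → ℕ := fun j => Finset.univ.sup fun i => (b j i).natDegree
  have he : ∀ j i, (b j i).natDegree ≤ e j := fun j i =>
    Finset.le_sup (f := fun i => (b j i).natDegree) (Finset.mem_univ i)
  let G : Fin D → ι → MvPolynomial (Fin 2) ℂ := fun j i => binaryForm (e j) (b j i)
  have hG : ∀ (w : Fin 2 → ℂ) (hw : w 0 ≠ 0), (fun j => evalVec (G j) w) =
      (fun j => Units.mk0 (w 0) hw ^ e j) • fun j i => (b j i).eval (w 1 / w 0) := by
    intro w hw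
    funext j i
    simp only [evalVec, G, eval_binaryForm_of_ne_zero (he j i) hw]
    simp [Units.smul_def]
  have hGind : ∀ w : Fin 2 → ℂ, w 0 ≠ 0 → LinearIndependent ℂ fun j => evalVec (G j) w := by
    intro w hw
    rw [hG w hw]
    exact (hbind _).units_smul _
  have hGspan : ∀ w : Fin 2 → ℂ, w 0 ≠ 0 → Submodule.span ℂ (Set.range fun j => evalVec (G j) w) =
      Submodule.span ℂ (Set.range fun j i => (b j i).eval (w 1 / w 0)) := by
    intro w hw
    rw [hG w hw]
    refine le_antisymm (Submodule.span_le.2 ?_) (Submodule.span_le.2 ?_)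
    · rintro _ ⟨j, rfl⟩
      exact Submodule.smul_mem _ _ (Submodule.subset_span ⟨j, rfl⟩)
    · rintro _ ⟨j, rfl⟩
      refine (Submodule.smul_mem_iff_of_isUnit _ (Units.mk0 (w 0) hw ^ e j).isUnit).1 ?_
      exact Submodule.subset_span ⟨j, rfl⟩
  -- Removing the power of `T` from `∏ a j` leaves `q` with `q(0) ≠ 0`, so the excluded closed set
  -- misses `[1 : 0]`. The removed power is nonzero at every other point of the chart.
  obtain ⟨q, hq, hq0⟩ := Polynomial.exists_eq_pow_rootMultiplicity_mul_and_not_dvd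
    (∏ j, S.a j) (Finset.prod_ne_zero_iff.2 fun j _ => ha j) 0
  rw [Polynomial.dvd_iff_isRoot, Polynomial.IsRoot.def] at hq0
  refine ⟨_, ⟨D, e, G, fun j i => isHomogeneous_binaryForm _ _, hGind _ rep_pointZero.1, rfl,
    {x | MvPolynomial.eval x.rep (MvPolynomial.X 0 * binaryForm q.natDegree q) = 0},
    isZariskiClosed_zeroLocus
      ((MvPolynomial.isHomogeneous_X ℂ 0).mul (isHomogeneous_binaryForm _ _)), ?_, ?_⟩, ?_⟩
  · rw [Set.mem_ofPred_eq, map_mul, MvPolynomial.eval_X,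
      eval_binaryForm_of_ne_zero le_rfl rep_pointZero.1, rep_pointZero.2, zero_div]
    exact mul_ne_zero rep_pointZero.1 (mul_ne_zero (pow_ne_zero _ rep_pointZero.1) hq0)
  · intro x _ hx hxZ
    rw [Set.mem_ofPred_eq, map_mul, MvPolynomial.eval_X] at hxZ
    have hx0 : x.rep 0 ≠ 0 := left_ne_zero_of_mul hxZ
    rw [eval_binaryForm_of_ne_zero le_rfl hx0] at hxZ
    have hqx := right_ne_zero_of_mul (right_ne_zero_of_mul hxZ)
    have hx1 : x.rep 1 ≠ 0 := fun h => hx (eq_pointZero_of_rep h)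
    refine ⟨hGind _ hx0, ?_⟩
    rw [hT x hx0, hGspan _ hx0]
    refine hbspan _ fun j => ?_
    have h := congrArg (Polynomial.eval (x.rep 1 / x.rep 0)) hq
    have h0 : Polynomial.eval (x.rep 1 / x.rep 0) (∏ j, S.a j) ≠ 0 := by
      rw [h, Polynomial.eval_mul, Polynomial.eval_pow]
      refine mul_ne_zero (pow_ne_zero _ ?_) hqx
      simpa using ⟨hx1, hx0⟩
    rw [Polynomial.eval_prod] at h0
    exact Finset.prod_ne_zero_iff.1 h0 j (Finset.mem_univ j)
  · intro l hl w hw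
    rw [hGspan _ rep_pointZero.1, rep_pointZero.2, zero_div] at hw
    have hlN : ∀ w ∈ Submodule.span (Polynomial ℂ) (Set.range g), l ⬝ᵥ w = 0 := by
      intro w hw
      induction hw using Submodule.span_induction with
      | mem w hw =>
        obtain ⟨a, rfl⟩ := hw
        exact hl a
      | zero => simp
      | add x y _ _ hx hy => rw [dotProduct_add, hx, hy, add_zero]
      | smul a x _ hx => rw [dotProduct_smul, hx, smul_zero]
    refine dotProduct_span ?_ hw
    rintro _ ⟨j, rfl⟩
    have h1 := hlN _ (hsnf j)
    rw [dotProduct_smul, smul_eq_mul] at h1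
    have h2 := congrArg (Polynomial.eval 0) ((mul_eq_zero.1 h1).resolve_left (ha j))
    simpa [dotProduct, Polynomial.eval_finsetSum] using h2

/-! ### The projective line as a smooth curve -/

theorem isSmoothCurve_univ : IsSmoothCurve (Set.univ : Set (ℙ ℂ (Fin 2 → ℂ))) where
  locallyClosed := by
    refine ⟨Set.univ, ∅, ⟨∅, by simp, by simp⟩, ⟨{1}, ?_, by simp⟩, by simp⟩
    rintro f rfl
    exact ⟨0, MvPolynomial.isHomogeneous_one _ _⟩
  nonempty := ⟨pointZero, trivial⟩
  irreducible := by
    rintro Z₁ Z₂ ⟨S₁, hS₁, hZ₁⟩ ⟨S₂, hS₂, hZ₂⟩ hcov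
    by_contra! hcon
    obtain ⟨x₁, -, hx₁⟩ := Set.not_subset.1 hcon.1
    obtain ⟨x₂, -, hx₂⟩ := Set.not_subset.1 hcon.2
    rw [hZ₁] at hx₁
    rw [hZ₂] at hx₂
    push Not at hx₁ hx₂
    obtain ⟨f₁, hf₁, hfx₁⟩ := hx₁
    obtain ⟨f₂, hf₂, hfx₂⟩ := hx₂
    obtain ⟨e₁, he₁⟩ := hS₁ f₁ hf₁
    obtain ⟨e₂, he₂⟩ := hS₂ f₂ hf₂
    -- The factor `X 0` disposes of the zero vector, which represents no point of the line.
    have hzero : MvPolynomial.X 0 * (f₁ * f₂) = 0 := by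
      refine MvPolynomial.funext fun w => ?_
      rw [map_mul, map_zero, MvPolynomial.eval_X]
      by_cases hw : w = 0
      · rw [hw, Pi.zero_apply, zero_mul]
      · obtain ⟨c, hc⟩ := Projectivization.exists_smul_eq_mk_rep ℂ w hw
        have h := eval_smul_of_isHomogeneous (he₁.mul he₂) (c : ℂ) w
        have hc' : (c : ℂ) • w = (Projectivization.mk ℂ w hw).rep := hc
        have hz : MvPolynomial.eval (Projectivization.mk ℂ w hw).rep (f₁ * f₂) = 0 := by
          rw [map_mul]
          rcases hcov (Set.mem_univ (Projectivization.mk ℂ w hw)) with h | h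
          · rw [(hZ₁ _).1 h f₁ hf₁, zero_mul]
          · rw [(hZ₂ _).1 h f₂ hf₂, mul_zero]
        rw [hc', hz] at h
        rw [(mul_eq_zero.1 h.symm).resolve_left (pow_ne_zero _ c.ne_zero), mul_zero]
    rcases mul_eq_zero.1 hzero with h | h
    · exact MvPolynomial.X_ne_zero 0 h
    · rcases mul_eq_zero.1 h with h | h
      · exact hfx₁ (by rw [h, map_zero])
      · exact hfx₂ (by rw [h, map_zero])
  smooth := by
    intro x _
    obtain ⟨i₀, hi₀⟩ := Function.ne_iff.1 x.rep_nonzero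
    rw [Pi.zero_apply] at hi₀
    let i₁ : Fin 2 := i₀.rev
    have hne : i₁ ≠ i₀ := by
      fin_cases i₀ <;> simp [i₁, Fin.rev]
    have hcases : ∀ i, i ≠ i₀ → i = i₁ := by
      intro i hi
      fin_cases i₀ <;> fin_cases i <;> simp_all [i₁, Fin.rev]
    refine ⟨i₀, fun y i => if i = i₀ then 1 else x.rep i / x.rep i₀ + y 0, ?_⟩
    refine isLocalParametrization_of_affine_leftInverse (fun y => ?_) ?_ ?_
      (ContinuousLinearMap.pi fun _ => ContinuousLinearMap.proj i₁)
      (fun _ => x.rep i₁ / x.rep i₀) fun y => ?_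
    · refine AnalyticAt.pi fun i => ?_
      by_cases h : i = i₀
      · simp only [if_pos h]
        exact analyticAt_const
      · simp only [if_neg h]
        exact analyticAt_const.add ((ContinuousLinearMap.proj (R := ℂ)
          (φ := fun _ : Fin 1 => ℂ) 0).analyticAt y)
    · ext w
      constructor
      · rintro ⟨y, rfl⟩
        exact ⟨if_pos rfl, fun h => one_ne_zero ((if_pos rfl).symm.trans (congrFun h i₀)), trivial⟩
      · rintro ⟨hw, -⟩
        refine ⟨fun _ => w i₁ - x.rep i₁ / x.rep i₀, ?_⟩
        funext i
        by_cases h : i = i₀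
        · simp only [if_pos h]
          rw [h, hw]
        · simp only [if_neg h]
          rw [hcases i h, add_sub_cancel]
    · have h0 : (fun i => if i = i₀ then 1 else x.rep i / x.rep i₀ + (0 : Fin 1 → ℂ) 0) =
          (x.rep i₀)⁻¹ • x.rep := by
        funext i
        by_cases h : i = i₀
        · simp [h, hi₀]
        · simp [h, div_eq_inv_mul]
      refine ⟨by rw [h0]; exact smul_ne_zero (inv_ne_zero hi₀) x.rep_nonzero, ?_⟩
      conv_rhs => rw [← x.mk_rep]
      exact (Projectivization.mk_eq_mk_iff' ℂ _ _ _ _).2 ⟨(x.rep i₀)⁻¹, h0.symm⟩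
    · funext j
      simp [hne, Subsingleton.elim j 0]

/-! ### Deforming functionals that vanish to high order -/

theorem eq_zero_of_dotProduct_mon {r : ℕ} {n d : Fin r → ℕ} {l : Index n d → ℂ}
    (h : ∀ u : ∀ i, Fin (n i + 1) → ℂ, l ⬝ᵥ mon u = 0) : l = 0 := by
  funext K
  refine coeff_eq_zero_of_vanishesToOrder (fun i => (0 : Fin (n i + 1))) l
    (offDegree (fun i => (0 : Fin (n i + 1))) K + 1) ?_ (Nat.lt_succ_self _)
  have : (fun u : ∀ i, Fin (n i + 1) → ℂ => ∑ K, l K * mon u K) = fun _ => 0 := funext h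
  rw [this]
  exact Asymptotics.isBigO_zero _ _

theorem offDegree_symOfFun {r : ℕ} {β : Fin r → Type} {d : Fin r → ℕ} [∀ i, DecidableEq (β i)]
    (o : ∀ i, β i) (κ : ∀ i, Fin (d i) → β i) :
    offDegree o (fun i => symOfFun (κ i)) =
      (Finset.univ.filter fun p : Σ i, Fin (d i) => κ p.1 p.2 ≠ o p.1).card := by
  rw [Finset.card_filter, Fintype.sum_sigma, offDegree]
  refine Finset.sum_congr rfl fun i _ => ?_
  rw [← Finset.card_filter, symOfFun, Sym.coe_mk, Multiset.filter_map, Multiset.card_map]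
  rfl

/-- The factors of a monomial that are to be shifted, given the labels of its factors. -/
theorem exists_shift {P J : Type*} [Fintype P] [DecidableEq P] [DecidableEq J] (j₀ : J)
    (lab : P → Option J) (k : ℕ)
    (h : 2 * k + 2 ≤ (Finset.univ.filter fun p => lab p ≠ some j₀).card) :
    ∃ S : Finset P, k + 1 ≤ (Finset.univ.filter fun p => lab p ≠ some j₀ ∧ p ∉ S).card ∧
      ∀ j, j ≠ j₀ →
        k + 1 ≤ (Finset.univ.filter fun p => lab p ≠ some j₀ ∧ (p ∈ S ↔ lab p = some j)).card := by
  by_cases hex : ∃ j₁, j₁ ≠ j₀ ∧ k + 1 ≤ (Finset.univ.filter fun p => lab p = some j₁).card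
  · obtain ⟨j₁, hj₁, hcard⟩ := hex
    obtain ⟨A, hA, hAcard⟩ := Finset.exists_subset_card_eq hcard
    have hA' : ∀ p ∈ A, lab p = some j₁ := fun p hp => (Finset.mem_filter.1 (hA hp)).2
    -- The `k + 1` unshifted factors in `A` serve for `j₀` and for every label other than `j₁`. For
    -- `j₁` all counted factors outside `A` serve, and at least `2k + 2 - (k + 1)` of them exist.
    refine ⟨(Finset.univ.filter fun p => lab p = some j₁) \ A, ?_, fun j hj => ?_⟩
    · rw [← hAcard]
      refine Finset.card_le_card fun p hp => ?_
      simp [hA' p hp, hj₁, hp]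
    · by_cases hjj : j = j₁
      · subst hjj
        have h1 : (Finset.univ.filter fun p => lab p ≠ some j₀) \ A ⊆
            Finset.univ.filter fun p => lab p ≠ some j₀ ∧
              (p ∈ (Finset.univ.filter fun p => lab p = some j) \ A ↔ lab p = some j) := by
          intro p hp
          simp only [Finset.mem_sdiff, Finset.mem_filter, Finset.mem_univ, true_and] at hp ⊢
          exact ⟨hp.1, fun h => h.1, fun h => ⟨h, hp.2⟩⟩
        have h2 := Finset.card_le_card h1
        have h3 := Finset.le_card_sdiff A (Finset.univ.filter fun p => lab p ≠ some j₀)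
        omega
      · rw [← hAcard]
        refine Finset.card_le_card fun p hp => ?_
        simp [hA' p hp, hj₁, hp, Ne.symm hjj]
  · push Not at hex
    -- Every label other than `j₀` now occurs at most `k` times, so discarding it leaves at least `k
    -- + 2` factors.
    refine ⟨∅, ?_, fun j hj => ?_⟩
    · simp only [Finset.notMem_empty, not_false_eq_true, and_true]
      omega
    · have h1 : (Finset.univ.filter fun p => lab p ≠ some j₀) \
          (Finset.univ.filter fun p => lab p = some j) ⊆
            Finset.univ.filter fun p => lab p ≠ some j₀ ∧
              (p ∈ (∅ : Finset P) ↔ lab p = some j) := by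
        intro p hp
        simp only [Finset.mem_sdiff, Finset.mem_filter, Finset.mem_univ, true_and] at hp
        simp [hp.1, hp.2]
      have h2 := Finset.card_le_card h1
      have h3 := Finset.le_card_sdiff (Finset.univ.filter fun p => lab p = some j)
        (Finset.univ.filter fun p => lab p ≠ some j₀)
      have h4 := hex j hj
      omega

theorem vanishesToOrder_prod_linear {P E : Type*} [Fintype P] [NormedAddCommGroup E]
    [NormedSpace ℂ E] [FiniteDimensional ℂ E] (f : P → E →ₗ[ℂ] ℂ) (x : E) {k : ℕ}
    (s : Finset P) (hs : ∀ p ∈ s, f p x = 0) (hk : k ≤ s.card) :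
    VanishesToOrder k (fun y => ∏ p, f p y) x := by
  classical
  have h := VanishesToOrder.prod Finset.univ (F := fun p y => f p y)
    (a := fun p => if p ∈ s then 1 else 0) (x := x) fun p _ => by
      have hd : DifferentiableAt ℂ (fun y => f p y) x :=
        (LinearMap.toContinuousLinearMap (f p)).differentiableAt
      split_ifs with hp
      · exact vanishesToOrder_one_of_differentiableAt hd (hs p hp)
      · exact vanishesToOrder_zero_of_continuousAt hd.continuousAt
  refine h.mono ?_
  simpa using hk

section Deform

variable {r : ℕ} {n d : Fin r → ℕ} {β : Fin r → Type} [∀ i, Fintype (β i)]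
  [∀ i, DecidableEq (β i)]

theorem exists_coeff_mon_equivFun (B : ∀ i, Module.Basis (β i) ℂ (Fin (n i + 1) → ℂ))
    (l : Index n d → ℂ) : ∃ c : (∀ i, Sym (β i) (d i)) → ℂ, ∀ u : ∀ i, Fin (n i + 1) → ℂ,
      l ⬝ᵥ mon u = ∑ K, c K * mon (fun i => (B i).equivFun (u i)) K := by
  choose κ hκ using fun (K : Index n d) i => symOfFun_surjective (K i)
  refine ⟨fun K' => ∑ K, l K * formProdCoeff (fun i q b => B i b (κ K i q)) K', fun u => ?_⟩
  simp only [Finset.sum_mul]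
  rw [Finset.sum_comm, dotProduct]
  refine Finset.sum_congr rfl fun K _ => ?_
  simp only [mul_assoc]
  rw [← Finset.mul_sum, sum_formProdCoeff_mul_mon]
  congr 1
  conv_lhs => rw [← (funext (hκ K) : (fun i => symOfFun (κ K i)) = K)]
  rw [mon_symOfFun]
  refine Finset.prod_congr rfl fun i _ => Finset.prod_congr rfl fun q _ => ?_
  have h := congrFun ((B i).sum_equivFun (u i)) (κ K i q)
  rw [← h, Finset.sum_apply]
  refine Finset.sum_congr rfl fun b _ => ?_
  rw [Pi.smul_apply, smul_eq_mul, mul_comm]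

theorem coeff_eq_zero_of_vanishesToOrder_basis
    (B : ∀ i, Module.Basis (β i) ℂ (Fin (n i + 1) → ℂ)) (o : ∀ i, β i)
    {l : Index n d → ℂ} {c : (∀ i, Sym (β i) (d i)) → ℂ}
    (hc : ∀ u : ∀ i, Fin (n i + 1) → ℂ,
      l ⬝ᵥ mon u = ∑ K, c K * mon (fun i => (B i).equivFun (u i)) K) {k : ℕ}
    (hl : VanishesToOrder k (fun u => l ⬝ᵥ mon u) fun i => B i (o i))
    {K : ∀ i, Sym (β i) (d i)} (hK : offDegree o K < k) : c K = 0 := by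
  refine coeff_eq_zero_of_vanishesToOrder o c k ?_ hK
  refine hl.transport (c := fun _ => 1)
    (g := fun x i => (B i).equivFun.symm (x i)) ?_ ?_ continuousAt_const
    (Filter.Eventually.of_forall fun x => ?_)
  · refine differentiableAt_pi.2 fun i => ?_
    have h1 : DifferentiableAt ℂ (fun x : ∀ i, β i → ℂ => x i) fun i => Pi.single (o i) 1 := by
      fun_prop
    exact (LinearMap.toContinuousLinearMap
      ((B i).equivFun.symm : (β i → ℂ) →ₗ[ℂ] (Fin (n i + 1) → ℂ))).differentiableAt.comp _ h1
  · funext i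
    simp
  · simp only [hc, one_mul, LinearEquiv.apply_symm_apply]

/-- `J` labels the points and `ε i` the remaining basis vectors of the `i`-th factor. Both summands
of `J ⊕ ε i` supply factors of the monomials, but only labels in `J` are ever shifted for. -/
theorem exists_deformation {J : Type} [DecidableEq J] {ε : Fin r → Type}
    [∀ i, Fintype (J ⊕ ε i)] [∀ i, DecidableEq (J ⊕ ε i)]
    (B : ∀ i, Module.Basis (J ⊕ ε i) ℂ (Fin (n i + 1) → ℂ)) (j₀ : J) (k : ℕ)
    (l : Index n d → ℂ)
    (hl : VanishesToOrder (2 * k + 2) (fun u => l ⬝ᵥ mon u) fun i => B i (Sum.inl j₀)) :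
    ∃ L : Index n d → Polynomial ℂ, (fun K => (L K).eval 0) = l ∧ ∀ τ : ℂ,
      VanishesToOrder (k + 1) (fun u => (fun K => (L K).eval τ) ⬝ᵥ mon u)
        (fun i => B i (Sum.inl j₀)) ∧
      ∀ j, j ≠ j₀ → VanishesToOrder (k + 1) (fun u => (fun K => (L K).eval τ) ⬝ᵥ mon u)
        (fun i => B i (Sum.inl j₀) + τ • B i (Sum.inl j)) := by
  classical
  obtain ⟨c, hc⟩ := exists_coeff_mon_equivFun B l
  let o : ∀ i, J ⊕ ε i := fun _ => Sum.inl j₀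
  choose κ hκ using fun (K : ∀ i, Sym (J ⊕ ε i) (d i)) i => symOfFun_surjective (K i)
  have hκK : ∀ K, (fun i => symOfFun (κ K i)) = K := fun K => funext (hκ K)
  have hlab : ∀ i (b : J ⊕ ε i) j, b.getLeft? = some j ↔ b = Sum.inl j := by
    intro i b j
    rw [Sum.getLeft?_eq_some_iff]
  have hsh : ∀ K : ∀ i, Sym (J ⊕ ε i) (d i), ∃ S : Finset (Σ i, Fin (d i)), c K ≠ 0 →
      k + 1 ≤ (Finset.univ.filter fun p : Σ i, Fin (d i) =>
        κ K p.1 p.2 ≠ Sum.inl j₀ ∧ p ∉ S).card ∧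
      ∀ j, j ≠ j₀ → k + 1 ≤ (Finset.univ.filter fun p : Σ i, Fin (d i) =>
        κ K p.1 p.2 ≠ Sum.inl j₀ ∧ (p ∈ S ↔ κ K p.1 p.2 = Sum.inl j)).card := by
    intro K
    by_cases hcK : c K = 0
    · exact ⟨∅, fun h => absurd hcK h⟩
    · have hdeg : 2 * k + 2 ≤ offDegree o K := by
        by_contra hlt
        exact hcK (coeff_eq_zero_of_vanishesToOrder_basis B o hc hl (not_le.1 hlt))
      rw [← hκK K, offDegree_symOfFun] at hdeg
      obtain ⟨S, hS⟩ := exists_shift j₀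
        (fun p : Σ i, Fin (d i) => (κ K p.1 p.2).getLeft?) k (by simpa only [ne_eq, hlab] using hdeg)
      exact ⟨S, fun _ => by simpa only [ne_eq, hlab] using hS⟩
  choose S hS using hsh
  let X : ∀ i, (J ⊕ ε i) → Fin (n i + 1) → ℂ := fun i b a => (B i).coord b (Pi.single a 1)
  have hX : ∀ i b (u : Fin (n i + 1) → ℂ), ∑ a, X i b a * u a = (B i).coord b u := by
    intro i b u
    conv_rhs => rw [pi_eq_sum_univ' u, map_sum]
    refine Finset.sum_congr rfl fun a _ => ?_
    rw [map_smul, smul_eq_mul, mul_comm]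
  -- The factors of the deformed monomial `K`: the coordinate `x_b`, replaced by `x_b - T x_{j₀}` at
  -- the positions in `S K`.
  let form : (∀ i, Sym (J ⊕ ε i) (d i)) → ∀ i, Fin (d i) → Fin (n i + 1) → Polynomial ℂ :=
    fun K i q a => Polynomial.C (X i (κ K i q) a) -
      if (⟨i, q⟩ : Σ i, Fin (d i)) ∈ S K then Polynomial.X * Polynomial.C (X i (Sum.inl j₀) a)
      else 0
  let L : Index n d → Polynomial ℂ := fun K' => ∑ K, Polynomial.C (c K) * formProdCoeff (form K) K'
  let f : ℂ → (∀ i, Sym (J ⊕ ε i) (d i)) → (Σ i, Fin (d i)) →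
      ((∀ i, Fin (n i + 1) → ℂ) →ₗ[ℂ] ℂ) := fun τ K p =>
    ((B p.1).coord (κ K p.1 p.2) - if p ∈ S K then τ • (B p.1).coord (Sum.inl j₀) else 0) ∘ₗ
      LinearMap.proj p.1
  have hf : ∀ τ K p u, f τ K p u = (B p.1).coord (κ K p.1 p.2) (u p.1) -
      if p ∈ S K then τ * (B p.1).coord (Sum.inl j₀) (u p.1) else 0 := by
    intro τ K p u
    simp only [f, LinearMap.comp_apply, LinearMap.sub_apply, LinearMap.proj_apply]
    split_ifs <;> rfl
  have hL : ∀ τ u, (fun K => (L K).eval τ) ⬝ᵥ mon u = ∑ K, c K * ∏ p, f τ K p u := by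
    intro τ u
    have h1 : ∀ K K', (formProdCoeff (form K) K').eval τ =
        formProdCoeff (fun i q a => (form K i q a).eval τ) K' := fun K K' =>
      map_formProdCoeff (Polynomial.evalRingHom τ) (form K) K'
    simp only [L, dotProduct, Polynomial.eval_finsetSum, Polynomial.eval_mul, Polynomial.eval_C,
      h1, Finset.sum_mul]
    rw [Finset.sum_comm]
    refine Finset.sum_congr rfl fun K _ => ?_
    simp only [mul_assoc]
    rw [← Finset.mul_sum, sum_formProdCoeff_mul_mon, Fintype.prod_sigma]
    congr 1
    refine Finset.prod_congr rfl fun i _ => Finset.prod_congr rfl fun q _ => ?_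
    rw [hf, ← hX, ← hX]
    by_cases hp : (⟨i, q⟩ : Σ i, Fin (d i)) ∈ S K
    · simp only [form, if_pos hp, Polynomial.eval_sub, Polynomial.eval_mul, Polynomial.eval_X,
        Polynomial.eval_C, sub_mul, Finset.sum_sub_distrib, Finset.mul_sum, mul_assoc]
    · simp only [form, if_neg hp, sub_zero, Polynomial.eval_C]
  have hvan : ∀ (τ : ℂ) (x : ∀ i, Fin (n i + 1) → ℂ) (s : (∀ i, Sym (J ⊕ ε i) (d i)) →
      Finset (Σ i, Fin (d i))), (∀ K, ∀ p ∈ s K, f τ K p x = 0) →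
      (∀ K, c K ≠ 0 → k + 1 ≤ (s K).card) →
      VanishesToOrder (k + 1) (fun u => (fun K => (L K).eval τ) ⬝ᵥ mon u) x := by
    intro τ x s hs hcard
    simp only [hL]
    refine VanishesToOrder.sum _ fun K _ => ?_
    by_cases hcK : c K = 0
    · simp only [hcK, zero_mul]
      exact Asymptotics.isBigO_zero _ _
    · exact Asymptotics.IsBigO.const_mul_left
        (vanishesToOrder_prod_linear (f τ K) x (s K) (hs K) (hcard K hcK)) _
  refine ⟨L, ?_, fun τ => ⟨?_, fun j hj => ?_⟩⟩
  · rw [← sub_eq_zero]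
    refine eq_zero_of_dotProduct_mon fun u => ?_
    rw [sub_dotProduct, hL, hc, sub_eq_zero]
    refine Finset.sum_congr rfl fun K _ => ?_
    conv_rhs => rw [← hκK K]
    rw [mon_symOfFun, Fintype.prod_sigma, hκK K]
    congr 1
    refine Finset.prod_congr rfl fun i _ => Finset.prod_congr rfl fun q _ => ?_
    rw [hf]
    simp
  · refine hvan τ _ _ (fun K p hp => ?_) fun K hK => (hS K hK).1
    obtain ⟨-, hp0, hpS⟩ := Finset.mem_filter.1 hp
    rw [hf, if_neg hpS, sub_zero, Module.Basis.coord_apply, Module.Basis.repr_self,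
      Finsupp.single_apply, if_neg hp0.symm]
  · refine hvan τ _ _ (fun K p hp => ?_) fun K hK => (hS K hK).2 j hj
    obtain ⟨-, hp0, hpS⟩ := Finset.mem_filter.1 hp
    have hne : (Sum.inl j : J ⊕ ε p.1) ≠ Sum.inl j₀ := fun h => hj (Sum.inl_injective h)
    rw [hf]
    -- At `v_{j₀} + τ v_j` the coordinate `x_{j₀}` is `1` and `x_b` is `τ` or `0` according as `b =
    -- j` or not. The shift occurs exactly when `b = j`, so the difference is zero.
    simp only [map_add, map_smul, Module.Basis.coord_apply, Module.Basis.repr_self,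
      Finsupp.single_apply, if_neg hp0.symm, if_neg hne, smul_eq_mul, hpS, if_true, mul_zero,
      add_zero, mul_one, zero_add]
    by_cases h : κ K p.1 p.2 = Sum.inl j
    · simp [h]
    · simp [h, Ne.symm h]

theorem exists_basis_extending {ι V : Type*} [AddCommGroup V] [Module ℂ V]
    [FiniteDimensional ℂ V] {v : ι → V} (hv : LinearIndependent ℂ v) :
    ∃ (m : ℕ) (B : Module.Basis (ι ⊕ Fin m) ℂ V), ∀ j, B (Sum.inl j) = v j := by
  obtain ⟨q, hq⟩ := Submodule.exists_isCompl (Submodule.span ℂ (Set.range v))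
  refine ⟨_, ((Module.Basis.span hv).prod (Module.finBasis ℂ q)).map
    (Submodule.prodEquivOfIsCompl _ _ hq), fun j => ?_⟩
  simp [Module.Basis.span_apply]

theorem exists_deformation_of_linearIndependent {m : ℕ} [NeZero m]
    {v : Fin m → ∀ i, Fin (n i + 1) → ℂ} (hv : ∀ i, LinearIndependent ℂ fun j => v j i) (k : ℕ)
    (l : Index n d → ℂ) (hl : VanishesToOrder (2 * k + 2) (fun u => l ⬝ᵥ mon u) (v 0)) :
    ∃ L : Index n d → Polynomial ℂ, (fun K => (L K).eval 0) = l ∧ ∀ τ : ℂ,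
      VanishesToOrder (k + 1) (fun u => (fun K => (L K).eval τ) ⬝ᵥ mon u) (v 0) ∧
      ∀ j, j ≠ 0 → VanishesToOrder (k + 1) (fun u => (fun K => (L K).eval τ) ⬝ᵥ mon u)
        (fun i => v 0 i + τ • v j i) := by
  classical
  choose ε B hB using fun i => exists_basis_extending (hv i)
  have h := exists_deformation B (0 : Fin m) k l (by simpa only [hB] using hl)
  simpa only [hB] using h

end Deform

/-! ### General points -/

theorem isMultihomogeneous_of_isWeightedHomogeneous {ι : Type} [Fintype ι] {m : ℕ}
    {f : MvPolynomial (Fin m × ι) ℂ} {e : Fin m → ℕ}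
    (h : ∀ j, f.IsWeightedHomogeneous (fun x : Fin m × ι => if x.1 = j then 1 else 0) (e j)) :
    IsMultihomogeneous f e := by
  intro s hs j
  rw [← h j (MvPolynomial.mem_support_iff.1 hs), Finsupp.weight_apply,
    Finsupp.sum_fintype _ _ (by simp), Fintype.sum_prod_type, Finset.sum_eq_single j]
  · simp
  · intro j' _ hj'
    simp [hj']
  · simp

section General

variable {r : ℕ} [NeZero r] {n d : Fin r → ℕ}

/-- The product over `i` of the determinants of the matrices whose rows are the coordinates
`∏ x_{i', 0}^{d_{i'}} x_{i, b} / x_{i, 0}`, `b ≤ n 0`, of the points. -/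
def generalPositionForm (hd : ∀ i, 0 < d i) (hmono : Monotone n) :
    MvPolynomial (Fin (n 0 + 1) × Index n d) ℂ :=
  ∏ i, Matrix.det (Matrix.of fun (j b : Fin (n 0 + 1)) => MvPolynomial.X
    (j, neighbourIndex hd (fun _ => 0) i
      (Fin.castLE (Nat.succ_le_succ (hmono (Fin.zero_le i))) b)))

/-- Each of the `r` determinants is linear in each row, and the `j`-th row only involves the
variables of the `j`-th point. -/
theorem isMultihomogeneous_generalPositionForm (hd : ∀ i, 0 < d i) (hmono : Monotone n) :
    IsMultihomogeneous (generalPositionForm hd hmono) fun _ => r := by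
  refine isMultihomogeneous_of_isWeightedHomogeneous fun j => ?_
  have hr : r = ∑ _i : Fin r, 1 := by simp
  conv => arg 3; rw [hr]
  refine MvPolynomial.IsWeightedHomogeneous.prod _ _ _ fun i _ => ?_
  rw [Matrix.det_apply']
  refine MvPolynomial.IsWeightedHomogeneous.sum _ _ _ fun σ _ => ?_
  have h : ((Equiv.Perm.sign σ : ℤ) : MvPolynomial (Fin (n 0 + 1) × Index n d) ℂ) =
      MvPolynomial.C ((Equiv.Perm.sign σ : ℤ) : ℂ) := by simp
  rw [h]
  refine MvPolynomial.IsWeightedHomogeneous.C_mul ?_ _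
  have h1 : 1 = ∑ b : Fin (n 0 + 1), if σ b = j then 1 else 0 := by
    rw [Equiv.sum_comp σ (fun b => if b = j then 1 else 0)]
    simp
  refine Eq.subst (motive := fun e => MvPolynomial.IsWeightedHomogeneous _ _ e) h1.symm
    (MvPolynomial.IsWeightedHomogeneous.prod _ _ _ fun b _ => ?_)
  exact MvPolynomial.isWeightedHomogeneous_X ℂ _ _

/-- In the `j`-th row all entries share the factor `c j * v j i 0 ^ (d i - 1) * ⋯`, which comes out
of the determinant. What remains is a minor of the vectors `v j i`, so nonvanishing forces their
independence whatever the representatives. -/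
theorem eval_generalPositionForm (hd : ∀ i, 0 < d i) (hmono : Monotone n)
    (c : Fin (n 0 + 1) → ℂ) (v : Fin (n 0 + 1) → ∀ i, Fin (n i + 1) → ℂ)
    {w : Fin (n 0 + 1) → Index n d → ℂ} (hw : ∀ j, w j = c j • monomialMap n d (v j)) :
    MvPolynomial.eval (fun x : Fin (n 0 + 1) × Index n d => w x.1 x.2)
      (generalPositionForm hd hmono) =
      ∏ i, ((∏ j, c j * (v j i 0 ^ (d i - 1) * ∏ i' ∈ {i}ᶜ, v j i' 0 ^ d i')) *
        Matrix.det (Matrix.of fun (j b : Fin (n 0 + 1)) =>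
          v j i (Fin.castLE (Nat.succ_le_succ (hmono (Fin.zero_le i))) b))) := by
  rw [generalPositionForm, map_prod]
  refine Finset.prod_congr rfl fun i _ => ?_
  rw [RingHom.map_det, ← Matrix.det_mul_column]
  congr 1
  funext j b
  simp only [RingHom.mapMatrix_apply, Matrix.map_apply, Matrix.of_apply, MvPolynomial.eval_X, hw,
    Pi.smul_apply, smul_eq_mul, monomialMap_eq_mon, mon_neighbourIndex]
  ring

/-- The points for which the general position form vanishes. -/
def specialPosition (hd : ∀ i, 0 < d i) (hmono : Monotone n) :
    Set (Fin (n 0 + 1) → ℙ ℂ (Index n d → ℂ)) :=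
  {p | MvPolynomial.eval (fun x : Fin (n 0 + 1) × Index n d => (p x.1).rep x.2)
    (generalPositionForm hd hmono) = 0}

theorem isZariskiClosedPow_specialPosition (hd : ∀ i, 0 < d i) (hmono : Monotone n) :
    IsZariskiClosedPow (specialPosition hd hmono) :=
  ⟨{generalPositionForm hd hmono},
    by rintro f rfl; exact ⟨_, isMultihomogeneous_generalPositionForm hd hmono⟩,
    by simp [specialPosition]⟩

theorem linearIndependent_of_notMem_specialPosition (hd : ∀ i, 0 < d i) (hmono : Monotone n)
    {p : Fin (n 0 + 1) → ℙ ℂ (Index n d → ℂ)} (hp : p ∉ specialPosition hd hmono)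
    {v : Fin (n 0 + 1) → ∀ i, Fin (n i + 1) → ℂ}
    (hv : ∀ j, ∃ h : monomialMap n d (v j) ≠ 0, p j = Projectivization.mk ℂ _ h) (i : Fin r) :
    LinearIndependent ℂ fun j => v j i := by
  choose h0 hpv using hv
  choose c hc using fun j => Projectivization.exists_smul_eq_mk_rep ℂ _ (h0 j)
  rw [specialPosition, Set.mem_ofPred_eq, eval_generalPositionForm hd hmono (fun j => (c j : ℂ)) v
    (w := fun j => (p j).rep) (fun j => by rw [hpv j, ← hc j]; rfl)] at hp
  have hdet := right_ne_zero_of_mul (Finset.prod_ne_zero_iff.1 hp i (Finset.mem_univ i))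
  have hrows := Matrix.linearIndependent_rows_of_det_ne_zero hdet
  exact LinearIndependent.of_comp (LinearMap.funLeft ℂ ℂ
    (Fin.castLE (Nat.succ_le_succ (hmono (Fin.zero_le i))))) hrows

theorem exists_notMem_specialPosition (hd : ∀ i, 0 < d i) (hmono : Monotone n) :
    ∃ p, (∀ j, p j ∈ variety n d) ∧ p ∉ specialPosition hd hmono := by
  -- Points on moment curves: the minors become Vandermonde determinants at the distinct nodes `0,
  -- …, n 0`.
  let v : Fin (n 0 + 1) → ∀ i, Fin (n i + 1) → ℂ := fun j i b => ((j : ℕ) : ℂ) ^ (b : ℕ)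
  have hv0 : ∀ j i, v j i 0 = 1 := fun j i => by simp [v]
  have hne : ∀ j, monomialMap n d (v j) ≠ 0 := fun j =>
    monomialMap_ne_zero n d _ fun i h => by
      have := congrFun h 0
      rw [hv0] at this
      exact one_ne_zero this
  refine ⟨fun j => Projectivization.mk ℂ _ (hne j), fun j => mk_monomialMap_mem_variety hd _, ?_⟩
  choose c hc using fun j => Projectivization.exists_smul_eq_mk_rep ℂ _ (hne j)
  rw [specialPosition, Set.mem_ofPred_eq, eval_generalPositionForm hd hmono (fun j => (c j : ℂ)) v
    (w := fun j => (Projectivization.mk ℂ _ (hne j)).rep) (fun j => (hc j).symm)]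
  refine Finset.prod_ne_zero_iff.2 fun i _ => mul_ne_zero
    (Finset.prod_ne_zero_iff.2 fun j _ => ?_) ?_
  · simp only [hv0, one_pow, Finset.prod_const_one, mul_one]
    exact (c j).ne_zero
  · have h : (Matrix.of fun (j b : Fin (n 0 + 1)) =>
        v j i (Fin.castLE (Nat.succ_le_succ (hmono (Fin.zero_le i))) b)) =
        Matrix.vandermonde fun j : Fin (n 0 + 1) => ((j : ℕ) : ℂ) := by
      ext j b
      simp [v, Matrix.vandermonde_apply]
    rw [h, Matrix.det_vandermonde_ne_zero_iff]
    exact Nat.cast_injective.comp Fin.val_injective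

end General

/-! ### The images of lines -/

section Curve

variable {r : ℕ} {n d : Fin r → ℕ}

/-- The pencil `a + T b` over `ℂ[T]`. -/
def pencil (a b : ∀ i, Fin (n i + 1) → ℂ) (i : Fin r) (c : Fin (n i + 1)) : Polynomial ℂ :=
  Polynomial.C (a i c) + Polynomial.X * Polynomial.C (b i c)

theorem eval_pencil (a b : ∀ i, Fin (n i + 1) → ℂ) (τ : ℂ) :
    (fun i c => (pencil a b i c).eval τ) = fun i => a i + τ • b i := by
  funext i c
  simp only [pencil, Polynomial.eval_add, Polynomial.eval_mul, Polynomial.eval_X, Polynomial.eval_C]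
  rfl

theorem natDegree_mon_pencil_le (a b : ∀ i, Fin (n i + 1) → ℂ) (K : Index n d) :
    (mon (pencil a b) K).natDegree ≤ ∑ i, d i := by
  choose κ hκ using fun i => symOfFun_surjective (K i)
  obtain rfl : (fun i => symOfFun (κ i)) = K := funext hκ
  rw [mon_symOfFun]
  refine (Polynomial.natDegree_prod_le _ _).trans (Finset.sum_le_sum fun i _ => ?_)
  refine (Polynomial.natDegree_prod_le _ _).trans ?_
  refine (Finset.sum_le_sum (g := fun _ => 1) fun q _ => ?_).trans (by simp)
  refine (Polynomial.natDegree_add_le _ _).trans (max_le (by simp) ?_)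
  refine Polynomial.natDegree_mul_le.trans ?_
  simp

theorem mon_const_smul {β : Fin r → Type} {R : Type*} [CommSemiring R] (c : R)
    (x : ∀ i, β i → R) (K : ∀ i, Sym (β i) (d i)) :
    mon (fun i => c • x i) K = c ^ (∑ i, d i) * mon x K := by
  rw [← Finset.prod_pow_eq_pow_sum]
  exact mon_smul (fun _ => c) x K

theorem eval_binaryForm_mon_pencil (a b : ∀ i, Fin (n i + 1) → ℂ) (K : Index n d)
    (w : Fin 2 → ℂ) :
    MvPolynomial.eval w (binaryForm (∑ i, d i) (mon (pencil a b) K)) =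
      mon (fun i => w 0 • a i + w 1 • b i) K := by
  let P : MvPolynomial (Fin 2) ℂ := mon (fun i c => MvPolynomial.X 0 * MvPolynomial.C (a i c) +
    MvPolynomial.X 1 * MvPolynomial.C (b i c)) K
  have hP : ∀ w, MvPolynomial.eval w P = mon (fun i => w 0 • a i + w 1 • b i) K := by
    intro w
    simp only [P, map_mon, map_add, map_mul, MvPolynomial.eval_X, MvPolynomial.eval_C]
    rfl
  -- Both polynomials agree by homogeneity where `w 0 ≠ 0`; the factor `X 0` extends the identity to
  -- all `w` and is then cancelled.
  suffices h : MvPolynomial.X 0 * (binaryForm (∑ i, d i) (mon (pencil a b) K) - P) = 0 by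
    have h' := (mul_eq_zero.1 h).resolve_left (MvPolynomial.X_ne_zero 0)
    rw [sub_eq_zero.1 h', hP]
  refine MvPolynomial.funext fun w => ?_
  rw [map_mul, map_sub, hP, MvPolynomial.eval_X, map_zero]
  by_cases hw : w 0 = 0
  · rw [hw, zero_mul]
  · have h1 : (mon (pencil a b) K).eval (w 1 / w 0) =
        mon (fun i c => (pencil a b i c).eval (w 1 / w 0)) K :=
      map_mon (Polynomial.evalRingHom (w 1 / w 0)) (pencil a b) K
    rw [eval_binaryForm_of_ne_zero (natDegree_mon_pencil_le a b K) hw, h1, eval_pencil,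
      ← mon_const_smul]
    simp only [smul_add, smul_smul, mul_div_cancel₀ _ hw, sub_self, mul_zero]

theorem monomialMap_pencil_ne_zero {a b : ∀ i, Fin (n i + 1) → ℂ}
    (hab : ∀ i, LinearIndependent ℂ ![a i, b i]) {s t : ℂ} (h : ![s, t] ≠ 0) :
    monomialMap n d (fun i => s • a i + t • b i) ≠ 0 := by
  refine monomialMap_ne_zero n d _ fun i hi => h ?_
  obtain ⟨rfl, rfl⟩ := LinearIndependent.pair_iff.1 (hab i) s t hi
  simp

open scoped Classical in
/-- The image of the line through `a` and `b` under the Segre-Veronese embedding. -/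
def lineImage (d : Fin r → ℕ) (a b : ∀ i, Fin (n i + 1) → ℂ) (x : ℙ ℂ (Fin 2 → ℂ)) :
    ℙ ℂ (Index n d → ℂ) :=
  if h : monomialMap n d (fun i => x.rep 0 • a i + x.rep 1 • b i) ≠ 0 then
    Projectivization.mk ℂ _ h
  -- A default value, never taken when `a i` and `b i` are independent for every `i`.
  else embedding n d fun _ => Projectivization.mk ℂ (fun _ => 1)
    (Function.ne_iff.2 ⟨0, one_ne_zero⟩)

theorem lineImage_mk {a b : ∀ i, Fin (n i + 1) → ℂ}
    (hab : ∀ i, LinearIndependent ℂ ![a i, b i]) (s t : ℂ) (h : ![s, t] ≠ 0) :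
    ∃ h' : monomialMap n d (fun i => s • a i + t • b i) ≠ 0,
      lineImage d a b (Projectivization.mk ℂ ![s, t] h) = Projectivization.mk ℂ _ h' := by
  refine ⟨monomialMap_pencil_ne_zero hab h, ?_⟩
  obtain ⟨c, hc⟩ := Projectivization.exists_smul_eq_mk_rep ℂ ![s, t] h
  have hc0 : (Projectivization.mk ℂ ![s, t] h).rep 0 = c * s := by rw [← hc]; rfl
  have hc1 : (Projectivization.mk ℂ ![s, t] h).rep 1 = c * t := by rw [← hc]; rfl
  have e : monomialMap n d (fun i => (Projectivization.mk ℂ ![s, t] h).rep 0 • a i +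
      (Projectivization.mk ℂ ![s, t] h).rep 1 • b i) =
      (c : ℂ) ^ (∑ i, d i) • monomialMap n d (fun i => s • a i + t • b i) := by
    funext K
    rw [hc0, hc1, Pi.smul_apply, smul_eq_mul, monomialMap_eq_mon, monomialMap_eq_mon,
      ← mon_const_smul]
    simp only [smul_add, smul_smul]
  have hne : monomialMap n d (fun i => (Projectivization.mk ℂ ![s, t] h).rep 0 • a i +
      (Projectivization.mk ℂ ![s, t] h).rep 1 • b i) ≠ 0 := by
    rw [e]
    exact smul_ne_zero (pow_ne_zero _ c.ne_zero) (monomialMap_pencil_ne_zero hab h)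
  rw [lineImage, dif_pos hne, Projectivization.mk_eq_mk_iff']
  exact ⟨_, e.symm⟩

theorem eq_mk_rep_pair (x : ℙ ℂ (Fin 2 → ℂ)) :
    ∃ h : ![x.rep 0, x.rep 1] ≠ 0, x = Projectivization.mk ℂ ![x.rep 0, x.rep 1] h := by
  have e : ![x.rep 0, x.rep 1] = x.rep := by
    funext i
    fin_cases i <;> rfl
  exact ⟨e ▸ x.rep_nonzero, by simp only [e, x.mk_rep]⟩

theorem lineImage_eq_mk {a b : ∀ i, Fin (n i + 1) → ℂ}
    (hab : ∀ i, LinearIndependent ℂ ![a i, b i]) (x : ℙ ℂ (Fin 2 → ℂ)) :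
    ∃ h' : monomialMap n d (fun i => x.rep 0 • a i + x.rep 1 • b i) ≠ 0,
      lineImage d a b x = Projectivization.mk ℂ _ h' := by
  obtain ⟨h, hx⟩ := eq_mk_rep_pair x
  obtain ⟨h', e⟩ := lineImage_mk (d := d) hab _ _ h
  rw [← hx] at e
  exact ⟨h', e⟩

theorem lineImage_mem_variety (hd : ∀ i, 0 < d i) {a b : ∀ i, Fin (n i + 1) → ℂ}
    (hab : ∀ i, LinearIndependent ℂ ![a i, b i]) (x : ℙ ℂ (Fin 2 → ℂ)) :
    lineImage d a b x ∈ variety n d := by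
  obtain ⟨h', e⟩ := lineImage_eq_mk (d := d) hab x
  rw [e]
  exact mk_monomialMap_mem_variety hd h'

theorem lineImage_pointZero {a b : ∀ i, Fin (n i + 1) → ℂ}
    (hab : ∀ i, LinearIndependent ℂ ![a i, b i]) (ha : monomialMap n d a ≠ 0) :
    lineImage d a b pointZero = Projectivization.mk ℂ _ ha := by
  obtain ⟨h', e⟩ := lineImage_mk (d := d) hab 1 0 (by simp)
  rw [pointZero, e]
  simp only [one_smul, zero_smul, add_zero]

theorem lineImage_pointInfty {a b : ∀ i, Fin (n i + 1) → ℂ}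
    (hab : ∀ i, LinearIndependent ℂ ![a i, b i]) (hb : monomialMap n d b ≠ 0) :
    lineImage d a b pointInfty = Projectivization.mk ℂ _ hb := by
  obtain ⟨h', e⟩ := lineImage_mk (d := d) hab 0 1 (by simp)
  rw [pointInfty, e]
  simp only [one_smul, zero_smul, zero_add]

theorem isMorphism_lineImage (hd : ∀ i, 0 < d i) {a b : ∀ i, Fin (n i + 1) → ℂ}
    (hab : ∀ i, LinearIndependent ℂ ![a i, b i]) :
    IsMorphism Set.univ (variety n d) (lineImage d a b) := by
  have hF : ∀ w : Fin 2 → ℂ,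
      evalVec (fun K : Index n d => binaryForm (∑ i, d i) (mon (pencil a b) K)) w =
        monomialMap n d (fun i => w 0 • a i + w 1 • b i) := fun w =>
    funext fun K => eval_binaryForm_mon_pencil a b K w
  refine ⟨fun x _ => lineImage_mem_variety hd hab x, fun x _ => ⟨_,
    fun K => binaryForm (∑ i, d i) (mon (pencil a b) K),
    fun K => isHomogeneous_binaryForm _ _, ?_, fun y _ h => ?_⟩⟩
  · rw [hF]
    exact (lineImage_eq_mk hab x).choose
  · obtain ⟨h', e⟩ := lineImage_eq_mk (d := d) hab y
    rw [e]
    congr 1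
    exact (hF _).symm

theorem exists_dual_pair {V : Type*} [AddCommGroup V] [Module ℂ V] [FiniteDimensional ℂ V]
    {a b : V} (hab : LinearIndependent ℂ ![a, b]) :
    ∃ f g : V →ₗ[ℂ] ℂ, f a = 1 ∧ f b = 0 ∧ g a = 0 ∧ g b = 1 := by
  obtain ⟨m, B, hB⟩ := exists_basis_extending hab
  have h0 : B (Sum.inl 0) = a := hB 0
  have h1 : B (Sum.inl 1) = b := hB 1
  refine ⟨B.coord (Sum.inl 0), B.coord (Sum.inl 1), ?_, ?_, ?_, ?_⟩ <;>
    simp [← h0, ← h1]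

/-- Take a product of `∑ i, d i` linear forms dual to `a i` or `b i`. On the pencil a form dual to
`a i` equals `1` and one dual to `b i` equals `T`; use the second kind exactly `l` times, counting
positions through `finSigmaFinEquiv`. -/
theorem exists_functional_mon_pencil {a b : ∀ i, Fin (n i + 1) → ℂ}
    (hab : ∀ i, LinearIndependent ℂ ![a i, b i]) {l : ℕ} (hl : l ≤ ∑ i, d i) :
    ∃ L : Index n d → ℂ, ∑ K, Polynomial.C (L K) * mon (pencil a b) K = Polynomial.X ^ l := by
  choose f g hfa hfb hga hgb using fun i => exists_dual_pair (hab i)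
  let form : ∀ i, Fin (d i) → ((Fin (n i + 1) → ℂ) →ₗ[ℂ] ℂ) := fun i q =>
    if (finSigmaFinEquiv (⟨i, q⟩ : Σ i, Fin (d i)) : ℕ) < l then g i else f i
  have hform : ∀ i q, ∑ c, Polynomial.C (form i q (Pi.single c 1)) * pencil a b i c =
      if (finSigmaFinEquiv (⟨i, q⟩ : Σ i, Fin (d i)) : ℕ) < l then Polynomial.X else 1 := by
    intro i q
    have h1 : ∀ u : Fin (n i + 1) → ℂ, ∑ c, form i q (Pi.single c 1) * u c = form i q u := by
      intro u
      conv_rhs => rw [pi_eq_sum_univ' u, map_sum]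
      refine Finset.sum_congr rfl fun c _ => ?_
      rw [map_smul, smul_eq_mul, mul_comm]
    have h2 : ∑ c, Polynomial.C (form i q (Pi.single c 1)) * pencil a b i c =
        Polynomial.C (form i q (a i)) + Polynomial.X * Polynomial.C (form i q (b i)) := by
      rw [← h1 (a i), ← h1 (b i), map_sum, map_sum, Finset.mul_sum, ← Finset.sum_add_distrib]
      refine Finset.sum_congr rfl fun c _ => ?_
      rw [pencil, map_mul, map_mul]
      ring
    rw [h2]
    simp only [form]
    split_ifs
    · simp [hga, hgb]
    · simp [hfa, hfb]
  refine ⟨formProdCoeff fun i q c => form i q (Pi.single c 1), ?_⟩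
  simp only [map_formProdCoeff]
  rw [sum_formProdCoeff_mul_mon]
  simp only [hform]
  rw [← Fintype.prod_sigma' (fun i (q : Fin (d i)) =>
    if (finSigmaFinEquiv (⟨i, q⟩ : Σ i, Fin (d i)) : ℕ) < l then Polynomial.X else
      (1 : Polynomial ℂ))]
  rw [Equiv.prod_comp finSigmaFinEquiv (fun x : Fin (∑ i, d i) =>
    if (x : ℕ) < l then Polynomial.X else (1 : Polynomial ℂ)), Finset.prod_ite,
    Finset.prod_const, Finset.prod_const_one, mul_one, Fin.card_filter_val_lt, min_eq_right hl]

/-- The `w_l` are the coefficient vectors of the monomials along the pencil. The functionals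
producing the powers of `T` form a dual family, which proves independence. -/
theorem isRationalNormalCurve_lineImage {a b : ∀ i, Fin (n i + 1) → ℂ}
    (hab : ∀ i, LinearIndependent ℂ ![a i, b i]) :
    IsRationalNormalCurve (∑ i, d i) (lineImage d a b) := by
  refine ⟨fun l K => (mon (pencil a b) K).coeff l, ?_, fun s t h => ?_⟩
  · rw [Fintype.linearIndependent_iff]
    intro c hc l
    obtain ⟨L, hL⟩ := exists_functional_mon_pencil hab (Nat.lt_succ_iff.1 l.2)
    have hdual : ∀ l' : ℕ, ∑ K, L K * (mon (pencil a b) K).coeff l' = if l' = l then 1 else 0 := by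
      intro l'
      have := congrArg (fun p => Polynomial.coeff p l') hL
      simpa only [Polynomial.finsetSum_coeff, Polynomial.coeff_C_mul, Polynomial.coeff_X_pow]
        using this
    have h1 : ∑ K, L K * ∑ l', c l' * (mon (pencil a b) K).coeff l' = 0 := by
      refine Finset.sum_eq_zero fun K _ => ?_
      have := congrFun hc K
      simp only [Finset.sum_apply, Pi.smul_apply, smul_eq_mul, Pi.zero_apply] at this
      rw [this, mul_zero]
    simp only [Finset.mul_sum] at h1
    rw [Finset.sum_comm] at h1
    have h2 : ∀ l' : Fin (∑ i, d i + 1), ∑ K, L K * (c l' * (mon (pencil a b) K).coeff l') =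
        c l' * if l' = l then 1 else 0 := by
      intro l'
      have := hdual l'
      simp only [Fin.val_inj] at this
      rw [← this, Finset.mul_sum]
      exact Finset.sum_congr rfl fun K _ => by ring
    simpa only [h2, mul_ite, mul_one, mul_zero, Finset.sum_ite_eq', Finset.mem_univ, if_true]
      using h1
  · have e : (∑ l : Fin (∑ i, d i + 1), (s ^ (∑ i, d i - (l : ℕ)) * t ^ (l : ℕ)) •
        fun K : Index n d => (mon (pencil a b) K).coeff l) =
        monomialMap n d (fun i => s • a i + t • b i) := by
      funext K
      have := eval_binaryForm_mon_pencil a b K ![s, t]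
      rw [eval_binaryForm, Finset.sum_range] at this
      rw [monomialMap_eq_mon]
      refine Eq.trans ?_ this
      rw [Finset.sum_apply]
      refine Finset.sum_congr rfl fun l _ => ?_
      simp [mul_comm]
    obtain ⟨h', hx⟩ := lineImage_mk (d := d) hab s t h
    refine ⟨by rw [e]; exact h', ?_⟩
    rw [hx]
    congr 1
    exact e.symm

end Curve

/-! ### Flat limits of spans of osculating spaces -/

theorem exists_isFlatLimit_spanOsculating {r : ℕ} {n d : Fin r → ℕ} (hd : ∀ i, 0 < d i) {m : ℕ}
    [NeZero m] {v : Fin m → ∀ i, Fin (n i + 1) → ℂ}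
    (hv : ∀ i, LinearIndependent ℂ fun j => v j i) (hv0 : monomialMap n d (v 0) ≠ 0)
    {γ : Fin m → ℙ ℂ (Fin 2 → ℂ) → ℙ ℂ (Index n d → ℂ)}
    (hγ : ∀ j, j ≠ 0 → ∀ x : ℙ ℂ (Fin 2 → ℂ), ∃ h : monomialMap n d
      (fun i => x.rep 0 • v 0 i + x.rep 1 • v j i) ≠ 0, γ j x = Projectivization.mk ℂ _ h) (k : ℕ) :
    ∃ T₀, IsFlatLimit Set.univ pointZero
      (spanOsculating (variety n d) (Projectivization.mk ℂ _ hv0) γ k) T₀ ∧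
      T₀ ≤ osculatingSpace (variety n d) (Projectivization.mk ℂ _ hv0) (2 * k + 1) := by
  -- Direction `0` for the fixed point makes its constant family an instance of the same formula.
  let b : Fin m → ∀ i, Fin (n i + 1) → ℂ := fun j => if j = 0 then 0 else v j
  let g : Fin m × {α : (Σ i, Fin (n i + 1)) →₀ ℕ // α.degree ≤ k} → Index n d → Polynomial ℂ :=
    fun a => jetCoeff (pencil (v 0) (b a.1)) a.2.1
  have hg : ∀ τ j α hα, (fun K => (g (j, ⟨α, hα⟩) K).eval τ) =
      (jetCoeff (fun i => v 0 i + τ • b j i) α : Index n d → ℂ) := by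
    intro τ j α hα
    funext K
    rw [← eval_pencil]
    exact map_jetCoeff (Polynomial.evalRingHom τ) _ _ _
  have hb0 : b 0 = 0 := if_pos rfl
  have hbj : ∀ j, j ≠ 0 → b j = v j := fun j hj => if_neg hj
  obtain ⟨T₀, hT₀, hann⟩ := exists_isFlatLimit g
    (spanOsculating (variety n d) (Projectivization.mk ℂ _ hv0) γ k) (by
      intro x hx
      have h0 : osculatingSpace (variety n d) (Projectivization.mk ℂ _ hv0) k =
          Submodule.span ℂ {w | ∃ α : (Σ i, Fin (n i + 1)) →₀ ℕ, α.degree ≤ k ∧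
            w = jetCoeff (fun i => v 0 i + (x.rep 1 / x.rep 0) • b 0 i) α} := by
        rw [osculatingSpace_variety hd hv0]
        simp only [hb0, Pi.zero_apply, smul_zero, add_zero]
      have hj : ∀ j, j ≠ 0 → osculatingSpace (variety n d) (γ j x) k =
          Submodule.span ℂ {w | ∃ α : (Σ i, Fin (n i + 1)) →₀ ℕ, α.degree ≤ k ∧
            w = jetCoeff (fun i => v 0 i + (x.rep 1 / x.rep 0) • b j i) α} := by
        intro j hj
        obtain ⟨h, hx'⟩ := hγ j hj x
        have e : monomialMap n d (fun i => x.rep 0 • v 0 i + x.rep 1 • v j i) =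
            x.rep 0 ^ (∑ i, d i) •
              monomialMap n d (fun i => v 0 i + (x.rep 1 / x.rep 0) • b j i) := by
          funext K
          rw [Pi.smul_apply, smul_eq_mul, monomialMap_eq_mon, monomialMap_eq_mon,
            ← mon_const_smul, hbj j hj]
          simp only [smul_add, smul_smul, mul_div_cancel₀ _ hx]
        have h' : monomialMap n d (fun i => v 0 i + (x.rep 1 / x.rep 0) • b j i) ≠ 0 := by
          intro h0
          rw [e, h0, smul_zero] at h
          exact h rfl
        rw [hx', ← osculatingSpace_variety hd h']
        congr 1
        exact (Projectivization.mk_eq_mk_iff' ℂ _ _ _ _).2 ⟨_, e.symm⟩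
      refine le_antisymm (sup_le ?_ (iSup₂_le fun j hj0 => ?_)) (Submodule.span_le.2 ?_)
      · rw [h0]
        refine Submodule.span_mono ?_
        rintro _ ⟨α, hα, rfl⟩
        exact ⟨(0, ⟨α, hα⟩), hg _ _ _ _⟩
      · rw [hj j hj0]
        refine Submodule.span_mono ?_
        rintro _ ⟨α, hα, rfl⟩
        exact ⟨(j, ⟨α, hα⟩), hg _ _ _ _⟩
      · rintro _ ⟨⟨j, α, hα⟩, rfl⟩
        rw [SetLike.mem_coe]
        beta_reduce
        rw [hg]
        by_cases hj0 : j = 0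
        · subst hj0
          refine Submodule.mem_sup_left ?_
          rw [h0]
          exact Submodule.subset_span ⟨α, hα, rfl⟩
        · refine Submodule.mem_sup_right (Submodule.mem_iSup_of_mem j
            (Submodule.mem_iSup_of_mem hj0 ?_))
          rw [hj j hj0]
          exact Submodule.subset_span ⟨α, hα, rfl⟩)
  refine ⟨T₀, hT₀, ?_⟩
  rw [← Submodule.span_eq T₀]
  refine span_le_of_dotProduct fun l hl w hw => ?_
  have hlv : VanishesToOrder (2 * k + 2) (fun u => l ⬝ᵥ mon u) (v 0) := by
    refine (vanishesToOrder_mon_iff l (v 0) _).2 fun α hα => hl _ ?_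
    rw [osculatingSpace_variety hd hv0]
    exact Submodule.subset_span ⟨α, by omega, rfl⟩
  obtain ⟨L, rfl, hL⟩ := exists_deformation_of_linearIndependent hv k l hlv
  refine hann L ?_ w hw
  rintro ⟨j, α, hα⟩
  -- Orthogonality over `ℂ[T]` is tested at each number `τ`, where it expresses vanishing to order
  -- `k + 1` at the moved point.
  refine Polynomial.funext fun τ => ?_
  have hvan : VanishesToOrder (k + 1) (fun u => (fun K => (L K).eval τ) ⬝ᵥ mon u)
      (fun i => v 0 i + τ • b j i) := by
    by_cases hj0 : j = 0
    · subst hj0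
      simpa only [hb0, Pi.zero_apply, smul_zero, add_zero] using (hL τ).1
    · rw [hbj j hj0]
      exact (hL τ).2 j hj0
  have h := (vanishesToOrder_mon_iff _ _ _).1 hvan α (Nat.lt_succ_iff.2 hα)
  rw [← hg τ j α hα] at h
  simpa [dotProduct, Polynomial.eval_finsetSum] using h

theorem linearIndependent_pair_of_ne {V : Type*} [AddCommGroup V] [Module ℂ V] {ι : Type*}
    {v : ι → V} (hv : LinearIndependent ℂ v) {i j : ι} (h : i ≠ j) :
    LinearIndependent ℂ ![v i, v j] := by
  have h1 : Function.Injective ![i, j] := by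
    intro a b hab
    fin_cases a <;> fin_cases b <;> simp_all
  have h2 := hv.comp _ h1
  convert h2 using 1
  funext a
  fin_cases a <;> rfl

end SegreVeronese

end

/-! ### The main theorem, outside the special position locus. -/

theorem mainTheorem4 {r : ℕ} [NeZero r] (n d : Fin r → ℕ) (hn : ∀ i, 0 < n i)
    (hd : ∀ i, 0 < d i) (hmono : Monotone n) :
    SegreVeronese.HasOsculatingRegularity (SegreVeronese.variety n d) (n 0 + 1) ∧
    SegreVeronese.ForGeneralPoints (SegreVeronese.variety n d) (n 0 + 1) (fun p =>
      ∀ v : Fin (n 0 + 1) → ∀ i, Fin (n i + 1) → ℂ,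
        (∀ j, ∃ h : SegreVeronese.monomialMap n d (v j) ≠ 0, p j = Projectivization.mk ℂ _ h) →
        ∃ γ : Fin (n 0 + 1) → Projectivization ℂ (Fin 2 → ℂ) →
            Projectivization ℂ (SegreVeronese.Index n d → ℂ),
          (∀ j, j ≠ 0 →
            (∀ (s t : ℂ) (h : ![s, t] ≠ 0),
              ∃ h' : SegreVeronese.monomialMap n d (fun i => s • v 0 i + t • v j i) ≠ 0,
                γ j (Projectivization.mk ℂ ![s, t] h) = Projectivization.mk ℂ _ h') ∧
            SegreVeronese.IsRationalNormalCurve (∑ i, d i) (γ j) ∧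
            (∀ x, γ j x ∈ SegreVeronese.variety n d) ∧
            γ j SegreVeronese.pointZero = p 0 ∧
            γ j SegreVeronese.pointInfty = p j) ∧
          ∀ k : ℕ, ∃ T₀ : Submodule ℂ (SegreVeronese.Index n d → ℂ),
            SegreVeronese.IsFlatLimit Set.univ SegreVeronese.pointZero
              (SegreVeronese.spanOsculating (SegreVeronese.variety n d) (p 0) γ k) T₀ ∧
            T₀ ≤ SegreVeronese.osculatingSpace (SegreVeronese.variety n d) (p 0) (2 * k + 1)) := by
  have main : ∀ p : Fin (n 0 + 1) → Projectivization ℂ (SegreVeronese.Index n d → ℂ),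
      p ∉ SegreVeronese.specialPosition hd hmono →
      ∀ v : Fin (n 0 + 1) → ∀ i, Fin (n i + 1) → ℂ,
        (∀ j, ∃ h : SegreVeronese.monomialMap n d (v j) ≠ 0, p j = Projectivization.mk ℂ _ h) →
        (∀ j, j ≠ 0 → ∀ i, LinearIndependent ℂ ![v 0 i, v j i]) ∧
        ∀ k : ℕ, ∃ T₀ : Submodule ℂ (SegreVeronese.Index n d → ℂ),
          SegreVeronese.IsFlatLimit Set.univ SegreVeronese.pointZero
            (SegreVeronese.spanOsculating (SegreVeronese.variety n d) (p 0)
              (fun j => SegreVeronese.lineImage d (v 0) (v j)) k) T₀ ∧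
          T₀ ≤ SegreVeronese.osculatingSpace (SegreVeronese.variety n d) (p 0) (2 * k + 1) := by
    intro p hp v hpv
    have hv := SegreVeronese.linearIndependent_of_notMem_specialPosition hd hmono hp hpv
    have hpair : ∀ j, j ≠ 0 → ∀ i, LinearIndependent ℂ ![v 0 i, v j i] := fun j hj i =>
      SegreVeronese.linearIndependent_pair_of_ne (hv i) hj.symm
    obtain ⟨h0, hp0⟩ := hpv 0
    refine ⟨hpair, fun k => ?_⟩
    rw [hp0]
    exact SegreVeronese.exists_isFlatLimit_spanOsculating hd hv h0
      (fun j hj x => SegreVeronese.lineImage_eq_mk (hpair j hj) x) k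
  have hZ := SegreVeronese.isZariskiClosedPow_specialPosition hd hmono
  have hne := SegreVeronese.exists_notMem_specialPosition hd hmono
  refine ⟨⟨_, hZ, hne, fun p hpX hp k => ?_⟩, ⟨_, hZ, hne, fun p hpX hp v hpv => ?_⟩⟩
  · choose x hx using hpX
    have hpv : ∀ j, ∃ h : SegreVeronese.monomialMap n d (fun i => (x j i).rep) ≠ 0,
        p j = Projectivization.mk ℂ _ h := fun j => ⟨_, (hx j).symm⟩
    obtain ⟨hpair, hlim⟩ := main p hp _ hpv
    obtain ⟨h0, hp0⟩ := hpv 0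
    refine ⟨1, Set.univ, fun j => SegreVeronese.lineImage d _ fun i => (x j i).rep,
      SegreVeronese.pointZero, SegreVeronese.pointInfty, SegreVeronese.isSmoothCurve_univ, trivial,
      trivial, fun j hj => ⟨SegreVeronese.isMorphism_lineImage hd (hpair j hj), ?_, ?_⟩, hlim k⟩
    · rw [hp0]
      exact SegreVeronese.lineImage_pointZero (hpair j hj) h0
    · obtain ⟨hj', hpj⟩ := hpv j
      rw [hpj]
      exact SegreVeronese.lineImage_pointInfty (hpair j hj) hj'
  · obtain ⟨hpair, hlim⟩ := main p hp v hpv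
    obtain ⟨h0, hp0⟩ := hpv 0
    refine ⟨_, fun j hj => ⟨SegreVeronese.lineImage_mk (hpair j hj),
      SegreVeronese.isRationalNormalCurve_lineImage (hpair j hj),
      SegreVeronese.lineImage_mem_variety hd (hpair j hj), ?_, ?_⟩, hlim⟩
    · rw [hp0]
      exact SegreVeronese.lineImage_pointZero (hpair j hj) h0
    · obtain ⟨hj', hpj⟩ := hpv j
      rw [hpj]
      exact SegreVeronese.lineImage_pointInfty (hpair j hj) hj'
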